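/- Let $\mathbb{H}_2$ be the Siegel upper half space of complex symmetric $2\times 2$ matrices with positive definite imaginary part. For $\tau\in\mathbb{H}_2$ put $A=\mathbb{C}^2/(\mathbb{Z}^2\oplus\tau\mathbb{Z}^2)$, with its standard principal polarization, given by the Hermitian form $H_\tau(z,w)={}^tz\,(\operatorname{Im}\tau)^{-1}\overline{w}$. For $n\ge 1$ the Weil pairing on $A[n]$ is $(z,w)\mapsto\exp(2\pi i\,n\operatorname{Im}H_\tau(z,w))$. If $K\subset A[n]$ is maximal isotropic for the Weil pairing, then $A/K$ carries the principal polarization whose pullback to $A$ is $n$ times that of $A$. A matrix $\tau'\in\mathbb{H}_2$ is a period matrix of a principally polarized complex abelian surface $X$ if $X$ is isomorphic, as a polarized abelian surface, to $\mathbb{C}^2/(\mathbb{Z}^2\oplus\tau'\mathbb{Z}^2)$ with its standard principal polarization. For $\gamma=\left(\begin{smallmatrix}a&b\\c&d\end{smallmatrix}\right)$ in $2\times2$ blocks write $\gamma\tau=(a\tau+b)(c\tau+d)^{-1}$. Let $\ell$ be a prime number. Let $S(\ell)$ be the set of matrices of one of the forms $$\left(\begin{smallmatrix}1&0&a&b\\0&1&b&c\\0&0&\ell&0\\0&0&0&\ell\end{smallmatrix}\right),\quad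 \left(\begin{smallmatrix}\ell&0&0&0\\-a&1&0&b\\0&0&1&a\\0&0&0&\ell\end{smallmatrix}\right),\quad \left(\begin{smallmatrix}1&0&a&0\\0&\ell&0&0\\0&0&\ell&0\\0&0&0&1\end{smallmatrix}\right),\quad \left(\begin{smallmatrix}\ell&0&0&0\\0&\ell&0&0\\0&0&1&0\\0&0&0&1\end{smallmatrix}\right)$$ with $a,b,c\in\{0,\ldots,\ell-1\}$. Let $S(\ell^2)$ be the set of matrices of one of the forms $$\left(\begin{smallmatrix}\ell&0&0&a\ell\\-b&1&a&ab+d\\0&0&\ell&b\ell\\0&0&0&\ell^2\end{smallmatrix}\right),\quad \left(\begin{smallmatrix}1&0&d&-a\\0&\ell&-\ell a&0\\0&0&\ell^2&0\\0&0&0&\ell\end{smallmatrix}\right),\quad \left(\begin{smallmatrix}\ell^2&0&0&0\\-a\ell&\ell&0&0\\0&0&1&a\\0&0&0&\ell\end{smallmatrix}\right),\quad \left(\begin{smallmatrix}\ell&0&0&0\\0&\ell^2&0&0\\0&0&\ell&0\\0&0&0&1\end{smallmatrix}\right)$$ with $a,b\in\{0,\ldots,\ell-1\}$ and $d\in\{0,\ldots,\ell^2-1\}$,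 or of the form $$\left(\begin{smallmatrix}\ell&0&a&b\\0&\ell&b&c\\0&0&\ell&0\\0&0&0&\ell\end{smallmatrix}\right)$$ with $a,b,c\in\{0,\ldots,\ell-1\}$, $ac\equiv b^2\pmod{\ell}$ and $(a,b,c)\ne(0,0,0)$. Proposition. Let $\tau\in\mathbb{H}_2$, let $A=\mathbb{C}^2/(\mathbb{Z}^2\oplus\tau\mathbb{Z}^2)$, and let $\ell$ be a prime number. 1. There is a bijection $\gamma\mapsto K_\gamma$ from $S(\ell)$ to the set of maximal isotropic subgroups of $A[\ell]$ such that, for every $\gamma\in S(\ell)$, the matrix $\gamma\tau$ lies in $\mathbb{H}_2$ and is a period matrix of $A/K_\gamma$. 2. There is a bijection $\gamma\mapsto K_\gamma$ from $S(\ell^2)$ to the set of maximal isotropic subgroups of $A[\ell^2]$ that are isomorphic to $(\mathbb{Z}/\ell\mathbb{Z})^2\times\mathbb{Z}/\ell^2\mathbb{Z}$ such that, for every $\gamma\in S(\ell^2)$, the matrix $\gamma\tau$ lies in $\mathbb{H}_2$ and is a period matrix of $A/K_\gamma$. -/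

import Mathlib

open Matrix

noncomputable section

/-- The Siegel upper half space of degree two: complex symmetric `2 × 2` matrices with positive
definite imaginary part. -/
def siegelHalfSpace : Set (Matrix (Fin 2) (Fin 2) ℂ) :=
  {τ | τ.IsSymm ∧ (τ.map Complex.im).PosDef}

/-- The lattice `ℤ² ⊕ τ ℤ²` in `ℂ²`. -/
def periodLattice (τ : Matrix (Fin 2) (Fin 2) ℂ) : AddSubgroup (Fin 2 → ℂ) where
  carrier := {z | ∃ p q : Fin 2 → ℤ, z = (fun i => (p i : ℂ)) + τ *ᵥ (fun i => (q i : ℂ))}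
  zero_mem' := ⟨0, 0, by ext i; fin_cases i <;> simp⟩
  add_mem' := by
    rintro _ _ ⟨p, q, rfl⟩ ⟨p', q', rfl⟩
    refine ⟨p + p', q + q', ?_⟩
    ext i
    fin_cases i <;> simp [vecHead, vecTail] <;> ring
  neg_mem' := by
    rintro _ ⟨p, q, rfl⟩
    refine ⟨-p, -q, ?_⟩
    ext i
    fin_cases i <;> simp [vecHead, vecTail] <;> ring

/-- The complex torus `A = ℂ² / (ℤ² ⊕ τ ℤ²)`. -/
abbrev AbelianSurface (τ : Matrix (Fin 2) (Fin 2) ℂ) : Type :=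
  (Fin 2 → ℂ) ⧸ periodLattice τ

/-- The positive definite Hermitian form `H(z, w) = ᵗz (Im τ)⁻¹ w̄` on `ℂ²`, for `τ` in the Siegel
upper half space. Its imaginary part is integral and unimodular on `ℤ² ⊕ τ ℤ²`, so that it is the
standard principal polarization of `ℂ² / (ℤ² ⊕ τ ℤ²)`. -/
def riemannForm (τ : Matrix (Fin 2) (Fin 2) ℂ) (z w : Fin 2 → ℂ) : ℂ :=
  z ⬝ᵥ (((τ.map Complex.im)⁻¹.map Complex.ofReal) *ᵥ star w)

/-- The Weil pairing `A[n] × A[n] → μ_n ⊆ ℂ` for the standard principal polarization: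
`(z mod Λ, w mod Λ) ↦ exp (2 π i n Im H(z, w))`. -/
def weilPairing (τ : Matrix (Fin 2) (Fin 2) ℂ) (n : ℕ)
    (x y : AddSubgroup.torsionBy (AbelianSurface τ) n) : ℂ :=
  Complex.exp (2 * Real.pi * Complex.I * n *
    ((riemannForm τ (Quotient.out x.1) (Quotient.out y.1)).im : ℂ))

theorem riemannForm_add_left (τ : Matrix (Fin 2) (Fin 2) ℂ) (z z' w : Fin 2 → ℂ) :
    riemannForm τ (z + z') w = riemannForm τ z w + riemannForm τ z' w := by
  simp [riemannForm, add_dotProduct]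

theorem riemannForm_add_right (τ : Matrix (Fin 2) (Fin 2) ℂ) (z w w' : Fin 2 → ℂ) :
    riemannForm τ z (w + w') = riemannForm τ z w + riemannForm τ z w' := by
  rw [riemannForm, star_add, Matrix.mulVec_add, dotProduct_add, riemannForm, riemannForm]

/-- The imaginary part of `H` on `ℤ² ⊕ τ ℤ²` is the standard symplectic form. -/
theorem riemannForm_im_lattice {τ : Matrix (Fin 2) (Fin 2) ℂ} (hτ : τ ∈ siegelHalfSpace)
    (p q p' q' : Fin 2 → ℤ) :
    (riemannForm τ ((fun i => (p i : ℂ)) + τ *ᵥ (fun i => (q i : ℂ)))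
      ((fun i => (p' i : ℂ)) + τ *ᵥ (fun i => (q' i : ℂ)))).im =
      ((q ⬝ᵥ p' - p ⬝ᵥ q' : ℤ) : ℝ) := by
  obtain ⟨hs, hp⟩ := hτ
  have h10 : τ 1 0 = τ 0 1 := hs.apply 0 1
  have hu : IsUnit (τ.map Complex.im).det := hp.det_pos.ne'.isUnit
  have h₁ := Matrix.nonsing_inv_mul _ hu
  have h₂ := Matrix.mul_nonsing_inv _ hu
  rw [riemannForm]
  generalize (τ.map Complex.im)⁻¹ = W at h₁ h₂ ⊢
  have e₁ := fun i j => congrFun (congrFun h₁ i) j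
  have e₂ := fun i j => congrFun (congrFun h₂ i) j
  have e₁00 := e₁ 0 0
  have e₁01 := e₁ 0 1
  have e₁10 := e₁ 1 0
  have e₁11 := e₁ 1 1
  have e₂00 := e₂ 0 0
  have e₂01 := e₂ 0 1
  have e₂10 := e₂ 1 0
  have e₂11 := e₂ 1 1
  simp [Matrix.mul_apply, Fin.sum_univ_two, h10] at e₁00 e₁01 e₁10 e₁11 e₂00 e₂01 e₂10 e₂11
  simp [dotProduct, Matrix.mulVec, vecHead, vecTail, Fin.sum_univ_two, h10]
  linear_combination
    -(p 0 + (τ 0 0).re * q 0 + (τ 0 1).re * q 1) * q' 0 * e₁00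
    - (p 0 + (τ 0 0).re * q 0 + (τ 0 1).re * q 1) * q' 1 * e₁01
    - (p 1 + (τ 0 1).re * q 0 + (τ 1 1).re * q 1) * q' 0 * e₁10
    - (p 1 + (τ 0 1).re * q 0 + (τ 1 1).re * q 1) * q' 1 * e₁11
    + q 0 * (p' 0 + (τ 0 0).re * q' 0 + (τ 0 1).re * q' 1) * e₂00
    + q 0 * (p' 1 + (τ 0 1).re * q' 0 + (τ 1 1).re * q' 1) * e₂01
    + q 1 * (p' 0 + (τ 0 0).re * q' 0 + (τ 0 1).re * q' 1) * e₂10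
    + q 1 * (p' 1 + (τ 0 1).re * q' 0 + (τ 1 1).re * q' 1) * e₂11

/-- The Weil pairing may be computed with any lifts to `ℂ²`. -/
theorem weilPairing_mk {τ : Matrix (Fin 2) (Fin 2) ℂ} (hτ : τ ∈ siegelHalfSpace) (n : ℕ)
    (z w : Fin 2 → ℂ)
    (hz : (z : AbelianSurface τ) ∈ AddSubgroup.torsionBy (AbelianSurface τ) n)
    (hw : (w : AbelianSurface τ) ∈ AddSubgroup.torsionBy (AbelianSurface τ) n) :
    weilPairing τ n ⟨z, hz⟩ ⟨w, hw⟩ =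
      Complex.exp (2 * Real.pi * Complex.I * n * ((riemannForm τ z w).im : ℂ)) := by
  have int : ∀ x ∈ periodLattice τ, ∀ y ∈ periodLattice τ,
      ∃ k : ℤ, (riemannForm τ x y).im = k := by
    rintro _ ⟨p, q, rfl⟩ _ ⟨p', q', rfl⟩
    exact ⟨_, riemannForm_im_lattice hτ p q p' q'⟩
  have tors : ∀ x : Fin 2 → ℂ, (x : AbelianSurface τ) ∈
      AddSubgroup.torsionBy (AbelianSurface τ) n → n • x ∈ periodLattice τ := by
    intro x hx
    rw [AddSubgroup.torsionBy.nsmul_iff] at hx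
    exact (QuotientAddGroup.eq_zero_iff _).1 hx
  have lift : ∀ x : Fin 2 → ℂ, ∃ y ∈ periodLattice τ,
      Quotient.out (x : AbelianSurface τ) = x + y := by
    intro x
    obtain ⟨y, hy⟩ := QuotientAddGroup.mk_out_eq_add (periodLattice τ) x
    exact ⟨y, y.2, hy⟩
  have hl : ∀ x y : Fin 2 → ℂ, (riemannForm τ (n • x) y).im = n * (riemannForm τ x y).im := by
    intro x y
    simp [riemannForm, vecHead, vecTail]
    ring
  have hr : ∀ x y : Fin 2 → ℂ, (riemannForm τ x (n • y)).im = n * (riemannForm τ x y).im := by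
    intro x y
    simp [riemannForm, vecHead, vecTail]
    ring
  obtain ⟨u, hu, hzu⟩ := lift z
  obtain ⟨v, hv, hwv⟩ := lift w
  obtain ⟨k₁, h₁⟩ := int _ (tors z hz) _ hv
  obtain ⟨k₂, h₂⟩ := int _ hu _ (tors w hw)
  obtain ⟨k₃, h₃⟩ := int _ hu _ hv
  rw [hl] at h₁
  rw [hr] at h₂
  have key : (n : ℝ) * (riemannForm τ (z + u) (w + v)).im =
      n * (riemannForm τ z w).im + ((k₁ + k₂ + n * k₃ : ℤ) : ℝ) := by
    simp only [riemannForm_add_left, riemannForm_add_right, Complex.add_im]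
    push_cast
    rw [← h₁, ← h₂, ← h₃]
    ring
  have key' : (n : ℂ) * ((riemannForm τ (z + u) (w + v)).im : ℂ) =
      n * ((riemannForm τ z w).im : ℂ) + ((k₁ + k₂ + n * k₃ : ℤ) : ℂ) := by
    exact_mod_cast congrArg (Complex.ofReal) key
  unfold weilPairing
  rw [hzu, hwv, mul_assoc _ (n : ℂ), key', mul_add, ← mul_assoc, Complex.exp_add,
    mul_comm _ ((k₁ + k₂ + n * k₃ : ℤ) : ℂ), Complex.exp_int_mul_two_pi_mul_I, mul_one]

/-- `K` is a subgroup of `A[n]` on which the Weil pairing is trivial. -/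
def IsIsotropic (τ : Matrix (Fin 2) (Fin 2) ℂ) (n : ℕ)
    (K : AddSubgroup (AbelianSurface τ)) : Prop :=
  ∃ h : K ≤ AddSubgroup.torsionBy (AbelianSurface τ) n,
    ∀ x y : K, weilPairing τ n ⟨x, h x.2⟩ ⟨y, h y.2⟩ = 1

/-- `K` is a maximal isotropic subgroup of `A[n]`. -/
def IsMaximalIsotropic (τ : Matrix (Fin 2) (Fin 2) ℂ) (n : ℕ)
    (K : AddSubgroup (AbelianSurface τ)) : Prop :=
  Maximal (IsIsotropic τ n) K

/-- The uniformization `ℂ² → A → A / K`. -/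
def quotientUniformization (τ : Matrix (Fin 2) (Fin 2) ℂ) (K : AddSubgroup (AbelianSurface τ)) :
    (Fin 2 → ℂ) →+ (AbelianSurface τ ⧸ K) :=
  (QuotientAddGroup.mk' K).comp (QuotientAddGroup.mk' (periodLattice τ))

/-- Let `X` be a complex torus uniformized by `π : ℂ² → X`, polarized by the Hermitian form `H` on
`ℂ²`. The matrix `τ'` is a (small) period matrix of `(X, H)` if it lies in the Siegel upper half
space and `(X, H)` is isomorphic, as a polarized complex torus, to `ℂ² / (ℤ² ⊕ τ' ℤ²)` with its
standard principal polarization: there is a group isomorphism `φ` which lifts to a `ℂ`-linear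
automorphism `g` of `ℂ²`, and which is compatible with the polarizations. -/
def IsPeriodMatrix {X : Type} [AddCommGroup X] (π : (Fin 2 → ℂ) →+ X)
    (H : (Fin 2 → ℂ) → (Fin 2 → ℂ) → ℂ) (τ' : Matrix (Fin 2) (Fin 2) ℂ) : Prop :=
  τ' ∈ siegelHalfSpace ∧
    ∃ (φ : AbelianSurface τ' ≃+ X) (g : (Fin 2 → ℂ) ≃ₗ[ℂ] (Fin 2 → ℂ)),
      (∀ z, φ (QuotientAddGroup.mk' (periodLattice τ') z) = π (g z)) ∧
      ∀ z w, H (g z) (g w) = riemannForm τ' z w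

/-- `τ'` is a period matrix of the quotient `A / K`, where `K` is maximal isotropic in `A[n]`.
The principal polarization on `A / K` is the one whose pullback to `A` is `n` times the standard
principal polarization of `A`. -/
def IsPeriodMatrixOfQuotient (τ : Matrix (Fin 2) (Fin 2) ℂ) (n : ℕ)
    (K : AddSubgroup (AbelianSurface τ)) (τ' : Matrix (Fin 2) (Fin 2) ℂ) : Prop :=
  IsPeriodMatrix (X := AbelianSurface τ ⧸ K) (quotientUniformization τ K) (fun z w => n * riemannForm τ z w) τ'

/-- The action `γ τ = (a τ + b) (c τ + d)⁻¹` of a matrix `γ` with `2 × 2` blocks `a, b, c, d`. -/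
def siegelAction (γ : Matrix (Fin 2 ⊕ Fin 2) (Fin 2 ⊕ Fin 2) ℤ) (τ : Matrix (Fin 2) (Fin 2) ℂ) :
    Matrix (Fin 2) (Fin 2) ℂ :=
  (γ.toBlocks₁₁.map (Int.cast : ℤ → ℂ) * τ + γ.toBlocks₁₂.map (Int.cast : ℤ → ℂ)) *
    (γ.toBlocks₂₁.map (Int.cast : ℤ → ℂ) * τ + γ.toBlocks₂₂.map (Int.cast : ℤ → ℂ))⁻¹

/-- The set `S(ℓ)`. -/
def heckeSet (l : ℕ) : Set (Matrix (Fin 2 ⊕ Fin 2) (Fin 2 ⊕ Fin 2) ℤ) :=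
  {γ | ∃ a ∈ Set.Ico (0 : ℤ) l, ∃ b ∈ Set.Ico (0 : ℤ) l, ∃ c ∈ Set.Ico (0 : ℤ) l,
      γ = fromBlocks !![1, 0; 0, 1] !![a, b; b, c] 0 !![(l : ℤ), 0; 0, l]} ∪
  {γ | ∃ a ∈ Set.Ico (0 : ℤ) l, ∃ b ∈ Set.Ico (0 : ℤ) l,
      γ = fromBlocks !![(l : ℤ), 0; -a, 1] !![0, 0; 0, b] 0 !![1, a; 0, (l : ℤ)]} ∪
  {γ | ∃ a ∈ Set.Ico (0 : ℤ) l,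
      γ = fromBlocks !![1, 0; 0, (l : ℤ)] !![a, 0; 0, 0] 0 !![(l : ℤ), 0; 0, 1]} ∪
  {fromBlocks !![(l : ℤ), 0; 0, l] 0 0 !![1, 0; 0, 1]}

/-- The set `S(ℓ²)`; the condition `a c = b²` in its last family is read modulo `ℓ`. -/
def heckeSetSq (l : ℕ) : Set (Matrix (Fin 2 ⊕ Fin 2) (Fin 2 ⊕ Fin 2) ℤ) :=
  {γ | ∃ a ∈ Set.Ico (0 : ℤ) l, ∃ b ∈ Set.Ico (0 : ℤ) l, ∃ d ∈ Set.Ico (0 : ℤ) (l ^ 2),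
      γ = fromBlocks !![(l : ℤ), 0; -b, 1] !![0, a * l; a, a * b + d] 0
        !![(l : ℤ), b * l; 0, l ^ 2]} ∪
  {γ | ∃ a ∈ Set.Ico (0 : ℤ) l, ∃ d ∈ Set.Ico (0 : ℤ) (l ^ 2),
      γ = fromBlocks !![1, 0; 0, (l : ℤ)] !![d, -a; -(l * a), 0] 0 !![(l : ℤ) ^ 2, 0; 0, l]} ∪
  {γ | ∃ a ∈ Set.Ico (0 : ℤ) l,
      γ = fromBlocks !![(l : ℤ) ^ 2, 0; -(a * l), l] 0 0 !![1, a; 0, (l : ℤ)]} ∪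
  {fromBlocks !![(l : ℤ), 0; 0, l ^ 2] 0 0 !![(l : ℤ), 0; 0, 1]} ∪
  {γ | ∃ a ∈ Set.Ico (0 : ℤ) l, ∃ b ∈ Set.Ico (0 : ℤ) l, ∃ c ∈ Set.Ico (0 : ℤ) l,
      a * c ≡ b ^ 2 [ZMOD l] ∧ (a, b, c) ≠ (0, 0, 0) ∧
      γ = fromBlocks !![(l : ℤ), 0; 0, l] !![a, b; b, c] 0 !![(l : ℤ), 0; 0, l]}

end

/-!
A subgroup of `A[n]` is the same thing as a lattice `M` with `n ℤ⁴ ⊆ M ⊆ ℤ⁴`, through the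
homomorphism `ℤ⁴ → A`, `(q, p) ↦ (p + τ q) / n`, which has image `A[n]` and kernel `n ℤ⁴`. In these
coordinates the Weil pairing is `exp (2 π i ω / n)`, with `ω` the standard symplectic form, so that
maximal isotropic subgroups correspond to the lattices `M` which are their own dual for `ω / n`
(`IsSelfDualLattice.isMaximalIsotropic_map`, `IsMaximalIsotropic.isSelfDualLattice_comap`).

If `γ = (A B; 0 D)` satisfies `A ᵗD = n` and `A ᵗB = B ᵗA`, its rows span a self-dual lattice, and
`z ↦ ᵗD z / n` carries `ℤ² ⊕ (γτ) ℤ²` onto the corresponding overlattice of `ℤ² ⊕ τ ℤ²` and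
the standard form of `γτ` to `n` times that of `τ`. Hence `γτ` is a period matrix of the quotient
(`isPeriodMatrixOfQuotient_rowLattice`).

What remains is a statement about lattices in `ℤ⁴`: the matrices of `S(ℓ)`, respectively `S(ℓ²)`,
are representatives of the self-dual lattices in question. Every self-dual lattice has a basis in
Hermite normal form (`IsSelfDualLattice.exists_hermite`), with `A` lower triangular, `D = n ᵗA⁻¹`,
and `B` determined modulo the rows of `D`; this form is essentially unique (`hermite_unique`). The
pivots `α`, `δ` of `A` divide `n`, and each admissible pair of pivots gives one of the families. For
`n = ℓ²`, the condition on the type of the subgroup `K` says that `M` has rank one modulo `ℓ`: the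
group `ℓ K` is the reduction of `M` modulo `ℓ`, and it is cyclic of order `ℓ`
(`hasRankOneMod_of_addEquiv`). Its `2 × 2` minors then vanish modulo `ℓ`, which excludes four of the
nine pairs of pivots and imposes the congruences on `B`. Conversely, for each of the five families
explicit linear forms on `ℤ⁴` exhibit the isomorphism of `K` with `(ℤ/ℓ)² × ℤ/ℓ²`
(`nonempty_addEquiv_of_mem_heckeSetSq`).
-/

/-! ### Self-dual lattices in `ℤ⁴` -/

/-- The standard symplectic form on `ℤ⁴`, in the coordinates `x = (q, p)`. -/
def stdSymplectic (x y : Fin 2 ⊕ Fin 2 → ℤ) : ℤ :=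
  (x ∘ Sum.inl) ⬝ᵥ (y ∘ Sum.inr) - (x ∘ Sum.inr) ⬝ᵥ (y ∘ Sum.inl)

theorem stdSymplectic_apply (x y : Fin 2 ⊕ Fin 2 → ℤ) :
    stdSymplectic x y = x (.inl 0) * y (.inr 0) + x (.inl 1) * y (.inr 1)
      - (x (.inr 0) * y (.inl 0) + x (.inr 1) * y (.inl 1)) := by
  simp [stdSymplectic, dotProduct, Fin.sum_univ_two]

theorem stdSymplectic_self (x : Fin 2 ⊕ Fin 2 → ℤ) : stdSymplectic x x = 0 := by
  rw [stdSymplectic_apply]; ring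

theorem stdSymplectic_swap (x y : Fin 2 ⊕ Fin 2 → ℤ) :
    stdSymplectic y x = -stdSymplectic x y := by
  simp only [stdSymplectic_apply]; ring

theorem stdSymplectic_add_left (x x' y : Fin 2 ⊕ Fin 2 → ℤ) :
    stdSymplectic (x + x') y = stdSymplectic x y + stdSymplectic x' y := by
  simp only [stdSymplectic_apply, Pi.add_apply]; ring

theorem stdSymplectic_smul_left (k : ℤ) (x y : Fin 2 ⊕ Fin 2 → ℤ) :
    stdSymplectic (k • x) y = k * stdSymplectic x y := by
  simp only [stdSymplectic_apply, Pi.smul_apply, smul_eq_mul]; ring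

theorem stdSymplectic_add_right (x y y' : Fin 2 ⊕ Fin 2 → ℤ) :
    stdSymplectic x (y + y') = stdSymplectic x y + stdSymplectic x y' := by
  simp only [stdSymplectic_apply, Pi.add_apply]; ring

theorem stdSymplectic_smul_right (k : ℤ) (x y : Fin 2 ⊕ Fin 2 → ℤ) :
    stdSymplectic x (k • y) = k * stdSymplectic x y := by
  simp only [stdSymplectic_apply, Pi.smul_apply, smul_eq_mul]; ring

/-- `M ⊆ ℤ⁴` is its own dual for the form `ω / n`. This forces `n ℤ⁴ ⊆ M`. -/
def IsSelfDualLattice (n : ℤ) (M : AddSubgroup (Fin 2 ⊕ Fin 2 → ℤ)) : Prop :=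
  ∀ x, x ∈ M ↔ ∀ y ∈ M, n ∣ stdSymplectic x y

theorem IsSelfDualLattice.smul_mem {n : ℤ} {M : AddSubgroup (Fin 2 ⊕ Fin 2 → ℤ)}
    (h : IsSelfDualLattice n M) (x : Fin 2 ⊕ Fin 2 → ℤ) : n • x ∈ M :=
  (h _).2 fun y _ => by rw [stdSymplectic_smul_left]; exact dvd_mul_right _ _

/-- The lattice spanned by the rows of `γ`. -/
def rowLattice (γ : Matrix (Fin 2 ⊕ Fin 2) (Fin 2 ⊕ Fin 2) ℤ) :
    AddSubgroup (Fin 2 ⊕ Fin 2 → ℤ) :=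
  (γ.vecMulLinear).toAddMonoidHom.range

theorem mem_rowLattice {γ : Matrix (Fin 2 ⊕ Fin 2) (Fin 2 ⊕ Fin 2) ℤ} {x : Fin 2 ⊕ Fin 2 → ℤ} :
    x ∈ rowLattice γ ↔ ∃ c, c ᵥ* γ = x := by
  simp [rowLattice]

theorem mem_rowLattice_fromBlocks {A B D : Matrix (Fin 2) (Fin 2) ℤ} {x : Fin 2 ⊕ Fin 2 → ℤ} :
    x ∈ rowLattice (fromBlocks A B 0 D) ↔
      ∃ u w : Fin 2 → ℤ, x = Sum.elim (u ᵥ* A) (u ᵥ* B + w ᵥ* D) := by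
  rw [mem_rowLattice]
  constructor
  · rintro ⟨c, rfl⟩
    refine ⟨c ∘ Sum.inl, c ∘ Sum.inr, ?_⟩
    rw [vecMul_fromBlocks]
    simp
  · rintro ⟨u, w, rfl⟩
    refine ⟨Sum.elim u w, ?_⟩
    rw [vecMul_fromBlocks]
    simp

theorem rowLattice_add_mul (A B D X : Matrix (Fin 2) (Fin 2) ℤ) :
    rowLattice (fromBlocks A (B + X * D) 0 D) = rowLattice (fromBlocks A B 0 D) := by
  ext x
  simp only [mem_rowLattice_fromBlocks]
  constructor
  · rintro ⟨u, w, rfl⟩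
    refine ⟨u, u ᵥ* X + w, ?_⟩
    rw [vecMul_add, add_vecMul, vecMul_vecMul, add_assoc]
  · rintro ⟨u, w, rfl⟩
    refine ⟨u, w - u ᵥ* X, ?_⟩
    rw [vecMul_add, sub_vecMul, vecMul_vecMul]
    congr 1
    abel

theorem stdSymplectic_elim (q p q' p' : Fin 2 → ℤ) :
    stdSymplectic (Sum.elim q p) (Sum.elim q' p') = q ⬝ᵥ p' - p ⬝ᵥ q' := by
  simp [stdSymplectic]

/-- If every integral functional `w ↦ v ⬝ᵥ w` is divisible by `n`, so is `v`. -/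
theorem exists_eq_smul_of_forall_dvd_dotProduct {n : ℤ} {v : Fin 2 → ℤ}
    (h : ∀ w : Fin 2 → ℤ, n ∣ v ⬝ᵥ w) : ∃ u : Fin 2 → ℤ, v = n • u := by
  have h' : ∀ i, n ∣ v i := fun i => by simpa using h (Pi.single i 1)
  choose u hu using h'
  exact ⟨u, funext fun i => by simp [hu]⟩

/-- The rows of a block upper triangular symplectic similitude of multiplier `n` span a lattice
which is self-dual for `ω / n`. -/
theorem isSelfDualLattice_rowLattice {n : ℤ} (hn : n ≠ 0) {A B D : Matrix (Fin 2) (Fin 2) ℤ}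
    (hAD : A * Dᵀ = n • (1 : Matrix (Fin 2) (Fin 2) ℤ))
    (hDA : Dᵀ * A = n • (1 : Matrix (Fin 2) (Fin 2) ℤ))
    (hAB : A * Bᵀ = B * Aᵀ) :
    IsSelfDualLattice n (rowLattice (fromBlocks A B 0 D)) := by
  have hDA' : D * Aᵀ = n • (1 : Matrix (Fin 2) (Fin 2) ℤ) := by
    simpa using congrArg transpose hAD
  have hAD' : Aᵀ * D = n • (1 : Matrix (Fin 2) (Fin 2) ℤ) := by
    simpa using congrArg transpose hDA
  -- moving a matrix across the dot product
  have vm : ∀ (v w : Fin 2 → ℤ) (X : Matrix (Fin 2) (Fin 2) ℤ), v ⬝ᵥ (w ᵥ* X) = (v ᵥ* Xᵀ) ⬝ᵥ w := by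
    intro v w X
    rw [← dotProduct_mulVec, mulVec_transpose]
  intro x
  constructor
  · intro hx y hy
    obtain ⟨u, w, rfl⟩ := mem_rowLattice_fromBlocks.1 hx
    obtain ⟨u', w', rfl⟩ := mem_rowLattice_fromBlocks.1 hy
    refine ⟨u ⬝ᵥ w' - w ⬝ᵥ u', ?_⟩
    rw [stdSymplectic_elim, vm, dotProduct_add, vm, vm, vecMul_vecMul, vecMul_vecMul, add_vecMul,
      vecMul_vecMul, vecMul_vecMul, hAB, hAD, hDA', add_dotProduct]
    simp only [vecMul_smul, vecMul_one, smul_dotProduct, smul_eq_mul]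
    ring
  · intro h
    obtain ⟨q, p, rfl⟩ : ∃ q p : Fin 2 → ℤ, x = Sum.elim q p :=
      ⟨x ∘ Sum.inl, x ∘ Sum.inr, by simp⟩
    obtain ⟨u, hu⟩ : ∃ u : Fin 2 → ℤ, q ᵥ* Dᵀ = n • u := by
      refine exists_eq_smul_of_forall_dvd_dotProduct fun w => ?_
      have := h _ (mem_rowLattice_fromBlocks.2 ⟨0, w, rfl⟩)
      rw [stdSymplectic_elim] at this
      simpa [vm] using this
    have hq : q = u ᵥ* A := by
      apply smul_right_injective _ hn
      have := congrArg (· ᵥ* A) hu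
      simpa only [vecMul_vecMul, hDA, vecMul_smul, smul_vecMul, vecMul_one] using this
    subst hq
    obtain ⟨w, hw⟩ : ∃ w : Fin 2 → ℤ, (p - u ᵥ* B) ᵥ* Aᵀ = n • w := by
      refine exists_eq_smul_of_forall_dvd_dotProduct fun u' => ?_
      have := h _ (mem_rowLattice_fromBlocks.2 ⟨u', 0, rfl⟩)
      rw [stdSymplectic_elim, zero_vecMul, add_zero, vm, vm, vecMul_vecMul, hAB] at this
      rw [sub_vecMul, vecMul_vecMul, sub_dotProduct, ← dvd_neg, neg_sub]
      exact this
    have hp : p - u ᵥ* B = w ᵥ* D := by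
      apply smul_right_injective _ hn
      have := congrArg (· ᵥ* D) hw
      simpa only [vecMul_vecMul, hAD', vecMul_smul, smul_vecMul, vecMul_one] using this
    exact mem_rowLattice_fromBlocks.2 ⟨u, w, by rw [← hp]; simp⟩

/-! ### Hermite normal forms -/

theorem exists_pos_generator {H : AddSubgroup ℤ} {n : ℤ} (hn : n ≠ 0) (h : n ∈ H) :
    ∃ d > 0, ∀ x, x ∈ H ↔ d ∣ x := by
  obtain ⟨a, rfl⟩ := Int.subgroup_cyclic H
  simp only [← AddSubgroup.zmultiples_eq_closure, Int.mem_zmultiples_iff] at h ⊢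
  refine ⟨|a|, abs_pos.2 ?_, fun x => (abs_dvd _ _).symm⟩
  rintro rfl
  exact hn (zero_dvd_iff.1 h)

/-- The matrix with rows `(α, 0, b₁, b₂)`, `(β, δ, b₃, b₄)`, `(0, 0, d₁, d₂)`, `(0, 0, 0, d₃)`. In
the order of coordinates `q₁, q₀, p₀, p₁`, and with the first two rows exchanged, it is upper
triangular. -/
abbrev hermiteMatrix (α β δ b₁ b₂ b₃ b₄ d₁ d₂ d₃ : ℤ) :
    Matrix (Fin 2 ⊕ Fin 2) (Fin 2 ⊕ Fin 2) ℤ :=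
  fromBlocks !![α, 0; β, δ] !![b₁, b₂; b₃, b₄] 0 !![d₁, d₂; 0, d₃]

/-- A self-dual lattice has a basis in Hermite normal form. With blocks `A, B, D`, the equations
say that `A ᵗD = n` and that `A ᵗB` is symmetric. -/
theorem IsSelfDualLattice.exists_hermite {n : ℤ} (hn : 0 < n)
    {M : AddSubgroup (Fin 2 ⊕ Fin 2 → ℤ)} (hM : IsSelfDualLattice n M) :
    ∃ α β δ d₁ d₂ d₃ b₁ b₂ b₃ b₄ : ℤ, 0 < α ∧ 0 < δ ∧ -α < β ∧ β ≤ 0 ∧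
      α * d₁ = n ∧ δ * d₃ = n ∧ β * d₁ + δ * d₂ = 0 ∧ α * b₃ = β * b₁ + δ * b₂ ∧
      M = rowLattice (hermiteMatrix α β δ b₁ b₂ b₃ b₄ d₁ d₂ d₃) := by
  have hn0 := hn.ne'
  -- the vector with coordinates `q = (q₀, q₁)` and `p = (p₀, p₁)`
  let e (q₀ q₁ p₀ p₁ : ℤ) : Fin 2 ⊕ Fin 2 → ℤ := Sum.elim ![q₀, q₁] ![p₀, p₁]
  have eta : ∀ x : Fin 2 ⊕ Fin 2 → ℤ, x = e (x (.inl 0)) (x (.inl 1)) (x (.inr 0)) (x (.inr 1)) := by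
    intro x
    ext (i | i) <;> fin_cases i <;> rfl
  have hω : ∀ q₀ q₁ p₀ p₁ q₀' q₁' p₀' p₁', stdSymplectic (e q₀ q₁ p₀ p₁) (e q₀' q₁' p₀' p₁') =
      q₀ * p₀' + q₁ * p₁' - (p₀ * q₀' + p₁ * q₁') := by
    intros
    simp [stdSymplectic_apply, e]
  have hadd : ∀ q₀ q₁ p₀ p₁ q₀' q₁' p₀' p₁', e q₀ q₁ p₀ p₁ + e q₀' q₁' p₀' p₁' =
      e (q₀ + q₀') (q₁ + q₁') (p₀ + p₀') (p₁ + p₁') := by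
    intros
    ext (i | i) <;> fin_cases i <;> rfl
  have hsmul : ∀ k q₀ q₁ p₀ p₁, k • e q₀ q₁ p₀ p₁ = e (k * q₀) (k * q₁) (k * p₀) (k * p₁) := by
    intros
    ext (i | i) <;> fin_cases i <;> rfl
  -- `δ` generates the last `q`-coordinates of `M`, and `α` the first ones where the last vanishes
  let H₁ : AddSubgroup ℤ :=
    { carrier := {t | ∃ q₀ p₀ p₁, e q₀ t p₀ p₁ ∈ M}
      zero_mem' := ⟨0, 0, 0, by simpa [hsmul] using M.zsmul_mem (hM.smul_mem (e 0 0 0 0)) 0⟩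
      add_mem' := by
        rintro a b ⟨_, _, _, h⟩ ⟨_, _, _, h'⟩
        have := M.add_mem h h'
        rw [hadd] at this
        exact ⟨_, _, _, this⟩
      neg_mem' := by
        rintro a ⟨_, _, _, h⟩
        have := M.zsmul_mem h (-1)
        rw [hsmul, neg_one_mul a] at this
        exact ⟨_, _, _, this⟩ }
  let H₀ : AddSubgroup ℤ :=
    { carrier := {t | ∃ p₀ p₁, e t 0 p₀ p₁ ∈ M}
      zero_mem' := ⟨0, 0, by simpa [hsmul] using M.zsmul_mem (hM.smul_mem (e 0 0 0 0)) 0⟩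
      add_mem' := by
        rintro a b ⟨_, _, h⟩ ⟨_, _, h'⟩
        have := M.add_mem h h'
        rw [hadd] at this
        exact ⟨_, _, this⟩
      neg_mem' := by
        rintro a ⟨_, _, h⟩
        have := M.zsmul_mem h (-1)
        rw [hsmul, neg_one_mul a] at this
        exact ⟨_, _, this⟩ }
  have hnH₁ : n ∈ H₁ := ⟨_, _, _, by simpa [hsmul] using hM.smul_mem (e 0 1 0 0)⟩
  have hnH₀ : n ∈ H₀ := ⟨_, _, by simpa [hsmul] using hM.smul_mem (e 1 0 0 0)⟩
  obtain ⟨δ, hδ, hδ'⟩ := exists_pos_generator hn0 hnH₁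
  obtain ⟨α, hα, hα'⟩ := exists_pos_generator hn0 hnH₀
  obtain ⟨d₃, hd₃⟩ := (hδ' n).1 hnH₁
  obtain ⟨d₁, hd₁⟩ := (hα' n).1 hnH₀
  obtain ⟨b₁, b₂', hr₁⟩ := (hα' α).2 dvd_rfl
  obtain ⟨β', b₃', b₄', hr₂'⟩ := (hδ' δ).2 dvd_rfl
  obtain ⟨β, b₃, b₄, hβ, hβ', hr₂⟩ : ∃ β b₃ b₄, -α < β ∧ β ≤ 0 ∧ e β δ b₃ b₄ ∈ M := by
    refine ⟨β' + (-β') / α * α, _, _, ?_, ?_,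
      by simpa [hadd, hsmul] using M.add_mem hr₂' (M.zsmul_mem hr₁ ((-β') / α))⟩
    · nlinarith [Int.emod_lt_of_pos (-β') hα, Int.mul_ediv_add_emod (-β') α]
    · nlinarith [Int.emod_nonneg (-β') hα.ne', Int.mul_ediv_add_emod (-β') α]
  -- `d₃ • (β, δ, ∗, ∗) - n • (0, 1, 0, 0)` has vanishing second coordinate
  obtain ⟨d₂', hd₂'⟩ : α ∣ d₃ * β := by
    refine (hα' _).1 ⟨d₃ * b₃, d₃ * b₄, ?_⟩
    have := M.add_mem (M.zsmul_mem hr₂ d₃) (hM.smul_mem (e 0 (-1) 0 0))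
    rw [hsmul, hsmul, hadd, show d₃ * δ + n * -1 = 0 by linear_combination -hd₃] at this
    simpa using this
  have hd₂ : β * d₁ + δ * -d₂' = 0 := by
    have : α * (β * d₁ + δ * -d₂') = 0 := by linear_combination (-β) * hd₁ + β * hd₃ + δ * hd₂'
    exact (mul_eq_zero.1 this).resolve_left hα.ne'
  have hr₄ : e 0 0 0 d₃ ∈ M := by
    refine (hM _).2 fun y hy => ?_
    rw [eta y] at hy ⊢
    obtain ⟨k, hk⟩ := (hδ' _).1 ⟨_, _, _, hy⟩
    rw [hω]
    exact ⟨-k, by rw [hk]; linear_combination k * hd₃⟩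
  have hr₃ : e 0 0 d₁ (-d₂') ∈ M := by
    refine (hM _).2 fun y hy => ?_
    rw [eta y] at hy ⊢
    obtain ⟨k, hk⟩ := (hδ' _).1 ⟨_, _, _, hy⟩
    obtain ⟨u, hu⟩ : α ∣ y (.inl 0) - k * β := by
      have := M.add_mem hy (M.zsmul_mem hr₂ (-k))
      rw [hsmul, hadd, hk, show δ * k + -k * δ = 0 by ring] at this
      rw [sub_eq_add_neg, ← neg_mul]
      exact (hα' _).1 ⟨_, _, this⟩
    rw [hω]
    exact ⟨-u, by rw [hk]; linear_combination (-d₁) * hu - k * hd₂ + u * hd₁⟩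
  -- adding a multiple of the fourth row to the first makes the first two rows orthogonal, not
  -- merely orthogonal modulo `n`
  obtain ⟨k, hk⟩ := (hM _).1 hr₁ _ hr₂
  rw [hω] at hk
  have hr₁' := M.add_mem hr₁ (M.zsmul_mem hr₄ k)
  rw [hsmul, hadd] at hr₁'
  simp only [mul_zero, add_zero] at hr₁'
  have hrow : ∀ u w, Sum.elim (u ᵥ* !![α, 0; β, δ])
      (u ᵥ* !![b₁, b₂' + k * d₃; b₃, b₄] + w ᵥ* !![d₁, -d₂'; 0, d₃]) =
      u 0 • e α 0 b₁ (b₂' + k * d₃) + u 1 • e β δ b₃ b₄ + w 0 • e 0 0 d₁ (-d₂') +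
        w 1 • e 0 0 0 d₃ := by
    intro u w
    simp only [hsmul, hadd]
    ext (i | i) <;> fin_cases i <;> simp [e, vecHead, vecTail]
    all_goals ring
  refine ⟨α, β, δ, d₁, -d₂', d₃, b₁, b₂' + k * d₃, b₃, b₄, hα, hδ, hβ, hβ', hd₁.symm, hd₃.symm, hd₂,
    by linear_combination hk + k * hd₃, ?_⟩
  ext x
  rw [mem_rowLattice_fromBlocks]
  constructor
  · intro hx
    obtain ⟨w, hw⟩ : δ ∣ x (.inl 1) := (hδ' _).1 ⟨_, _, _, by rw [← eta x]; exact hx⟩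
    obtain ⟨u, hu⟩ : α ∣ x (.inl 0) - w * β := by
      have := M.add_mem hx (M.zsmul_mem hr₂ (-w))
      rw [eta x, hsmul, hadd, hw, show δ * w + -w * δ = 0 by ring] at this
      rw [sub_eq_add_neg, ← neg_mul]
      exact (hα' _).1 ⟨_, _, this⟩
    -- subtracting the first two rows leaves a vector `(0, p)` orthogonal to them modulo `n`
    have hy := M.add_mem (M.add_mem hx (M.zsmul_mem hr₁' (-u))) (M.zsmul_mem hr₂ (-w))
    rw [eta x, hsmul, hsmul, hadd, hadd] at hy
    obtain ⟨s, hs⟩ := (hM _).1 hy _ hr₁'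
    obtain ⟨t, ht⟩ := (hM _).1 hy _ hr₂
    rw [hω] at hs ht
    have hs' : x (.inr 0) - u * b₁ - w * b₃ = -s * d₁ := by
      apply mul_left_cancel₀ hα.ne'
      rw [hw] at hs
      linear_combination b₁ * hu - hs - s * hd₁
    have ht' : x (.inr 1) - u * (b₂' + k * d₃) - w * b₄ = -s * -d₂' + -t * d₃ := by
      apply mul_left_cancel₀ hδ.ne'
      rw [hw] at ht
      linear_combination b₃ * hu - ht - β * hs' + s * hd₂ - t * hd₃
    refine ⟨![u, w], ![-s, -t], ?_⟩
    rw [hrow, eta x]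
    simp only [hsmul, hadd]
    congr 1 <;> simp
    · linear_combination hu
    · linear_combination hw
    · linear_combination hs'
    · linear_combination ht'
  · rintro ⟨u, w, rfl⟩
    rw [hrow]
    exact M.add_mem (M.add_mem (M.add_mem (M.zsmul_mem hr₁' _) (M.zsmul_mem hr₂ _))
      (M.zsmul_mem hr₃ _)) (M.zsmul_mem hr₄ _)

/-- Uniqueness of the Hermite normal form: the block `A` is determined up to reduction of `β`
modulo `α`, and then `B` is determined modulo the rows of `D`. -/
theorem hermite_unique {α β δ α' β' δ' : ℤ} {B D B' D' : Matrix (Fin 2) (Fin 2) ℤ}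
    (hα : 0 < α) (hδ : 0 < δ) (hα' : 0 < α') (hδ' : 0 < δ')
    (h : rowLattice (fromBlocks !![α, 0; β, δ] B 0 D) =
      rowLattice (fromBlocks !![α', 0; β', δ'] B' 0 D')) :
    α = α' ∧ δ = δ' ∧ α ∣ β - β' ∧
      (β = β' → D = D' → ∃ X : Matrix (Fin 2) (Fin 2) ℤ, B - B' = X * D) := by
  have key : ∀ {α β δ α' β' δ' : ℤ} {B D B' D' : Matrix (Fin 2) (Fin 2) ℤ},
      rowLattice (fromBlocks !![α, 0; β, δ] B 0 D) =
        rowLattice (fromBlocks !![α', 0; β', δ'] B' 0 D') → ∀ u : Fin 2 → ℤ,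
      ∃ u' w' : Fin 2 → ℤ, u 0 * α + u 1 * β = u' 0 * α' + u' 1 * β' ∧ u 1 * δ = u' 1 * δ' ∧
        u ᵥ* B = u' ᵥ* B' + w' ᵥ* D' := by
    intro α β δ α' β' δ' B D B' D' h u
    have hx := mem_rowLattice_fromBlocks (A := !![α, 0; β, δ]) (B := B) (D := D).2 ⟨u, 0, rfl⟩
    rw [h] at hx
    obtain ⟨u', w', hx⟩ := mem_rowLattice_fromBlocks.1 hx
    rw [Sum.elim_eq_iff] at hx
    refine ⟨u', w', ?_, ?_, by simpa using hx.2⟩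
    · simpa [vecMul, dotProduct, Fin.sum_univ_two] using congrFun hx.1 0
    · simpa [vecMul, dotProduct, Fin.sum_univ_two] using congrFun hx.1 1
  have dvdδ : ∀ {α β δ α' β' δ' : ℤ} {B D B' D' : Matrix (Fin 2) (Fin 2) ℤ},
      rowLattice (fromBlocks !![α, 0; β, δ] B 0 D) =
        rowLattice (fromBlocks !![α', 0; β', δ'] B' 0 D') → δ' ∣ δ := by
    intro α β δ α' β' δ' B D B' D' h
    obtain ⟨u', _, _, h2, _⟩ := key h ![0, 1]
    exact ⟨u' 1, by simpa [mul_comm] using h2⟩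
  have dvdα : ∀ {α β δ α' β' δ' : ℤ} {B D B' D' : Matrix (Fin 2) (Fin 2) ℤ}, 0 < δ' →
      rowLattice (fromBlocks !![α, 0; β, δ] B 0 D) =
        rowLattice (fromBlocks !![α', 0; β', δ'] B' 0 D') → α' ∣ α := by
    intro α β δ α' β' δ' B D B' D' hδ' h
    obtain ⟨u', _, h1, h2, _⟩ := key h ![1, 0]
    have h3 : u' 1 = 0 := by simpa [hδ'.ne'] using h2.symm
    exact ⟨u' 0, by simpa [h3, mul_comm] using h1⟩
  obtain rfl : δ = δ' := Int.dvd_antisymm hδ.le hδ'.le (dvdδ h.symm) (dvdδ h)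
  obtain rfl : α = α' := Int.dvd_antisymm hα.le hα'.le (dvdα hδ h.symm) (dvdα hδ h)
  refine ⟨rfl, rfl, ?_, ?_⟩
  · obtain ⟨u', _, h1, h2, _⟩ := key h ![0, 1]
    have h3 : u' 1 = 1 := by
      apply mul_right_cancel₀ hδ.ne'
      simpa using h2.symm
    exact ⟨u' 0, by simp [h3] at h1; linear_combination h1⟩
  · rintro rfl rfl
    have hrow : ∀ u : Fin 2 → ℤ, ∃ w : Fin 2 → ℤ, u ᵥ* B = u ᵥ* B' + w ᵥ* D := by
      intro u
      obtain ⟨u', w', h1, h2, h3⟩ := key h u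
      have h4 : u 1 = u' 1 := mul_right_cancel₀ hδ.ne' h2
      have h5 : u 0 = u' 0 := by
        apply mul_right_cancel₀ hα.ne'
        rw [h4] at h1
        linear_combination h1
      obtain rfl : u = u' := by
        ext i
        fin_cases i
        exacts [h5, h4]
      exact ⟨w', h3⟩
    choose w hw using hrow
    refine ⟨Matrix.of fun i => w (Pi.single i 1), ?_⟩
    ext i j
    have := congrFun (hw (Pi.single i 1)) j
    simp only [single_one_vecMul, Pi.add_apply] at this
    rw [Matrix.sub_apply, sub_eq_iff_eq_add']
    exact this

theorem hermiteMatrix_unique {α β δ b₁ b₂ b₃ b₄ d₁ d₂ d₃ α' β' δ' b₁' b₂' b₃' b₄' d₁' d₂' d₃' : ℤ}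
    (hα : 0 < α) (hδ : 0 < δ) (hα' : 0 < α') (hδ' : 0 < δ')
    (h : rowLattice (hermiteMatrix α β δ b₁ b₂ b₃ b₄ d₁ d₂ d₃) =
      rowLattice (hermiteMatrix α' β' δ' b₁' b₂' b₃' b₄' d₁' d₂' d₃')) :
    α = α' ∧ δ = δ' ∧ α ∣ β - β' ∧ (β = β' → d₁ = d₁' → d₂ = d₂' → d₃ = d₃' →
      ∃ x₁ x₂ x₃ x₄, b₁ - b₁' = x₁ * d₁ ∧ b₂ - b₂' = x₁ * d₂ + x₂ * d₃ ∧
        b₃ - b₃' = x₃ * d₁ ∧ b₄ - b₄' = x₃ * d₂ + x₄ * d₃) := by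
  obtain ⟨h₁, h₂, h₃, h₄⟩ := hermite_unique hα hδ hα' hδ' h
  refine ⟨h₁, h₂, h₃, ?_⟩
  rintro hβ rfl rfl rfl
  obtain ⟨X, hX⟩ := h₄ hβ rfl
  have e := fun i j => congrFun (congrFun hX i) j
  simp only [Matrix.sub_apply, Matrix.mul_apply, Fin.sum_univ_two] at e
  exact ⟨X 0 0, X 0 1, X 1 0, X 1 1, by simpa using e 0 0, by simpa using e 0 1,
    by simpa using e 1 0, by simpa using e 1 1⟩

theorem rowLattice_hermiteMatrix_congr {α β δ b₁ b₂ b₃ b₄ d₁ d₂ d₃ b₁' b₂' b₃' b₄' : ℤ}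
    (x₁ x₂ x₃ x₄ : ℤ) (h₁ : b₁' = b₁ + x₁ * d₁) (h₂ : b₂' = b₂ + x₁ * d₂ + x₂ * d₃)
    (h₃ : b₃' = b₃ + x₃ * d₁) (h₄ : b₄' = b₄ + x₃ * d₂ + x₄ * d₃) :
    rowLattice (hermiteMatrix α β δ b₁' b₂' b₃' b₄' d₁ d₂ d₃) =
      rowLattice (hermiteMatrix α β δ b₁ b₂ b₃ b₄ d₁ d₂ d₃) := by
  rw [hermiteMatrix, hermiteMatrix, ← rowLattice_add_mul _ !![b₁, b₂; b₃, b₄] _ !![x₁, x₂; x₃, x₄]]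
  congr 2
  ext i j
  fin_cases i <;> fin_cases j <;> simp [h₁, h₂, h₃, h₄, add_assoc]

/-- The entries of `(x₀, x₁, x₂, x₃) * γ` for `γ` in Hermite normal form. -/
theorem forall_vecMul_hermiteMatrix {P : ℤ → Prop} {α β δ b₁ b₂ b₃ b₄ d₁ d₂ d₃ : ℤ}
    {x : Fin 2 ⊕ Fin 2 → ℤ} :
    (∀ i, P ((x ᵥ* hermiteMatrix α β δ b₁ b₂ b₃ b₄ d₁ d₂ d₃) i)) ↔
      P (x (.inl 0) * α + x (.inl 1) * β) ∧ P (x (.inl 1) * δ) ∧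
      P (x (.inl 0) * b₁ + x (.inl 1) * b₃ + x (.inr 0) * d₁) ∧
      P (x (.inl 0) * b₂ + x (.inl 1) * b₄ + (x (.inr 0) * d₂ + x (.inr 1) * d₃)) := by
  rw [Sum.forall, Fin.forall_fin_two, Fin.forall_fin_two, vecMul_fromBlocks]
  simp [vecHead, vecTail, and_assoc]

theorem hermiteMatrix_row_mem (α β δ b₁ b₂ b₃ b₄ d₁ d₂ d₃ : ℤ) (i : Fin 2 ⊕ Fin 2) :
    hermiteMatrix α β δ b₁ b₂ b₃ b₄ d₁ d₂ d₃ i ∈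
      rowLattice (hermiteMatrix α β δ b₁ b₂ b₃ b₄ d₁ d₂ d₃) :=
  mem_rowLattice.2 ⟨Pi.single i 1, by rw [single_one_vecMul]; rfl⟩

/-- `γ` has the shape of a Hermite normal form and is a symplectic similitude of multiplier `n`; no
condition is put on the signs of the pivots or on the entries above them. -/
def IsHermiteSimilitude (n : ℤ) (γ : Matrix (Fin 2 ⊕ Fin 2) (Fin 2 ⊕ Fin 2) ℤ) : Prop :=
  ∃ α β δ b₁ b₂ b₃ b₄ d₁ d₂ d₃ : ℤ, α * d₁ = n ∧ δ * d₃ = n ∧ β * d₁ + δ * d₂ = 0 ∧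
    α * b₃ = β * b₁ + δ * b₂ ∧ γ = hermiteMatrix α β δ b₁ b₂ b₃ b₄ d₁ d₂ d₃

theorem IsHermiteSimilitude.exists_blocks {n : ℤ} (hn : n ≠ 0)
    {γ : Matrix (Fin 2 ⊕ Fin 2) (Fin 2 ⊕ Fin 2) ℤ} (h : IsHermiteSimilitude n γ) :
    ∃ A B D : Matrix (Fin 2) (Fin 2) ℤ, A * Dᵀ = n • (1 : Matrix (Fin 2) (Fin 2) ℤ) ∧
      Dᵀ * A = n • (1 : Matrix (Fin 2) (Fin 2) ℤ) ∧ A * Bᵀ = B * Aᵀ ∧ γ = fromBlocks A B 0 D := by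
  obtain ⟨α, β, δ, b₁, b₂, b₃, b₄, d₁, d₂, d₃, h₁, h₂, h₃, h₄, rfl⟩ := h
  have hδ : δ ≠ 0 := by
    rintro rfl
    exact hn (by rw [← h₂, zero_mul])
  have h₅ : d₂ * α + d₃ * β = 0 := by
    apply mul_left_cancel₀ hδ
    linear_combination α * h₃ - β * h₁ + β * h₂
  refine ⟨_, _, _, ?_, ?_, ?_, rfl⟩ <;> ext i j <;> fin_cases i <;> fin_cases j <;>
    simp [Matrix.mul_apply, Fin.sum_univ_two] <;> linarith

theorem IsHermiteSimilitude.isSelfDualLattice {n : ℤ} (hn : n ≠ 0)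
    {γ : Matrix (Fin 2 ⊕ Fin 2) (Fin 2 ⊕ Fin 2) ℤ} (h : IsHermiteSimilitude n γ) :
    IsSelfDualLattice n (rowLattice γ) := by
  obtain ⟨A, B, D, h₁, h₂, h₃, rfl⟩ := h.exists_blocks hn
  exact isSelfDualLattice_rowLattice hn h₁ h₂ h₃

/-! ### Maximal isotropic subgroups and self-dual lattices -/

/-- The point `p + τ q` of `ℤ² ⊕ τ ℤ²` with coordinates `x = (q, p)`. -/
noncomputable def latticeVector (τ : Matrix (Fin 2) (Fin 2) ℂ) :
    (Fin 2 ⊕ Fin 2 → ℤ) →+ (Fin 2 → ℂ) where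
  toFun x := (fun i => (x (.inr i) : ℂ)) + τ *ᵥ (fun i => (x (.inl i) : ℂ))
  map_zero' := by ext i; fin_cases i <;> simp
  map_add' x y := by
    ext i
    fin_cases i <;> simp [vecHead, vecTail] <;> ring

theorem latticeVector_apply (τ : Matrix (Fin 2) (Fin 2) ℂ) (x : Fin 2 ⊕ Fin 2 → ℤ) :
    latticeVector τ x = (fun i => (x (.inr i) : ℂ)) + τ *ᵥ (fun i => (x (.inl i) : ℂ)) := rfl

theorem mem_periodLattice_iff {τ : Matrix (Fin 2) (Fin 2) ℂ} {z : Fin 2 → ℂ} :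
    z ∈ periodLattice τ ↔ ∃ x, latticeVector τ x = z := by
  constructor
  · rintro ⟨p, q, rfl⟩
    exact ⟨Sum.elim q p, by simp [latticeVector_apply]⟩
  · rintro ⟨x, rfl⟩
    exact ⟨fun i => x (.inr i), fun i => x (.inl i), rfl⟩

theorem riemannForm_im_latticeVector {τ : Matrix (Fin 2) (Fin 2) ℂ} (hτ : τ ∈ siegelHalfSpace)
    (x y : Fin 2 ⊕ Fin 2 → ℤ) :
    (riemannForm τ (latticeVector τ x) (latticeVector τ y)).im = (stdSymplectic x y : ℝ) := by
  rw [latticeVector_apply, latticeVector_apply, riemannForm_im_lattice hτ]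
  rfl

theorem latticeVector_injective {τ : Matrix (Fin 2) (Fin 2) ℂ} (hτ : τ ∈ siegelHalfSpace) :
    Function.Injective (latticeVector τ) := by
  rw [injective_iff_map_eq_zero]
  intro x hx
  -- the symplectic form is nondegenerate and is read off from `Im H`
  have h : ∀ y, stdSymplectic x y = 0 := by
    intro y
    have := riemannForm_im_latticeVector hτ x y
    rw [hx] at this
    simpa [riemannForm] using this.symm
  ext (i | i)
  · have := h (Sum.elim 0 (Pi.single i 1))
    fin_cases i <;> simpa [stdSymplectic_apply] using this
  · have := h (Sum.elim (Pi.single i 1) 0)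
    fin_cases i <;> simpa [stdSymplectic_apply] using this

/-- The homomorphism `ℤ⁴ → A`, `(q, p) ↦ (p + τ q) / n`, with image `A[n]` and kernel `n ℤ⁴`. -/
noncomputable def torsionPoint (τ : Matrix (Fin 2) (Fin 2) ℂ) (n : ℕ) :
    (Fin 2 ⊕ Fin 2 → ℤ) →+ AbelianSurface τ where
  toFun x := (((n : ℂ)⁻¹ • latticeVector τ x : Fin 2 → ℂ) : AbelianSurface τ)
  map_zero' := by simp
  map_add' x y := by rw [map_add, smul_add]; rfl

theorem torsionPoint_apply (τ : Matrix (Fin 2) (Fin 2) ℂ) (n : ℕ) (x : Fin 2 ⊕ Fin 2 → ℤ) :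
    torsionPoint τ n x = (((n : ℂ)⁻¹ • latticeVector τ x : Fin 2 → ℂ) : AbelianSurface τ) := rfl

section

variable {τ : Matrix (Fin 2) (Fin 2) ℂ} {n : ℕ}

theorem inv_smul_latticeVector_smul (hn : n ≠ 0) (x : Fin 2 ⊕ Fin 2 → ℤ) :
    (n : ℂ)⁻¹ • latticeVector τ ((n : ℤ) • x) = latticeVector τ x := by
  rw [map_zsmul, natCast_zsmul, ← Nat.cast_smul_eq_nsmul ℂ, inv_smul_smul₀ (by exact_mod_cast hn)]

theorem torsionPoint_smul (hn : n ≠ 0) (x : Fin 2 ⊕ Fin 2 → ℤ) :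
    torsionPoint τ n ((n : ℤ) • x) = 0 := by
  rw [torsionPoint_apply, inv_smul_latticeVector_smul hn, QuotientAddGroup.eq_zero_iff,
    mem_periodLattice_iff]
  exact ⟨x, rfl⟩

/-- A lattice containing `n ℤ⁴` gives rise to a subgroup of `A[n]` whose preimage in `ℂ²` is
its image under `x ↦ (p + τ q) / n`. -/
theorem mk_mem_map_torsionPoint (hn : n ≠ 0) {M : AddSubgroup (Fin 2 ⊕ Fin 2 → ℤ)}
    (hM : ∀ x, (n : ℤ) • x ∈ M) {z : Fin 2 → ℂ} :
    (z : AbelianSurface τ) ∈ M.map (torsionPoint τ n) ↔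
      ∃ x ∈ M, (n : ℂ)⁻¹ • latticeVector τ x = z := by
  constructor
  · rintro ⟨x, hx, h⟩
    rw [torsionPoint_apply, QuotientAddGroup.eq, mem_periodLattice_iff] at h
    obtain ⟨y, hy⟩ := h
    refine ⟨x + (n : ℤ) • y, M.add_mem hx (hM y), ?_⟩
    rw [map_add, smul_add, inv_smul_latticeVector_smul hn, hy]
    abel
  · rintro ⟨x, hx, rfl⟩
    exact ⟨x, hx, rfl⟩

theorem comap_map_torsionPoint (hτ : τ ∈ siegelHalfSpace) (hn : n ≠ 0)
    {M : AddSubgroup (Fin 2 ⊕ Fin 2 → ℤ)} (hM : ∀ x, (n : ℤ) • x ∈ M) :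
    (M.map (torsionPoint τ n)).comap (torsionPoint τ n) = M := by
  ext x
  rw [AddSubgroup.mem_comap, torsionPoint_apply, mk_mem_map_torsionPoint hn hM]
  constructor
  · rintro ⟨y, hy, h⟩
    have h' := latticeVector_injective hτ
      (smul_right_injective _ (inv_ne_zero (Nat.cast_ne_zero.2 hn : (n : ℂ) ≠ 0)) h)
    rwa [← h']
  · exact fun hx => ⟨x, hx, rfl⟩

theorem torsionPoint_eq_zero_iff (hτ : τ ∈ siegelHalfSpace) (hn : n ≠ 0)
    {x : Fin 2 ⊕ Fin 2 → ℤ} : torsionPoint τ n x = 0 ↔ ∀ i, (n : ℤ) ∣ x i := by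
  constructor
  · intro h
    rw [torsionPoint_apply, QuotientAddGroup.eq_zero_iff, mem_periodLattice_iff] at h
    obtain ⟨y, hy⟩ := h
    rw [← inv_smul_latticeVector_smul hn] at hy
    have h' := latticeVector_injective hτ
      (smul_right_injective _ (inv_ne_zero (Nat.cast_ne_zero.2 hn : (n : ℂ) ≠ 0)) hy)
    intro i
    exact ⟨y i, by rw [← h']; rfl⟩
  · intro h
    choose y hy using h
    obtain rfl : x = (n : ℤ) • y := funext hy
    exact torsionPoint_smul hn y

theorem torsionBy_eq_range_torsionPoint (hn : n ≠ 0) :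
    AddSubgroup.torsionBy (AbelianSurface τ) n = (torsionPoint τ n).range := by
  ext a
  rw [AddSubgroup.torsionBy.nsmul_iff]
  constructor
  · obtain ⟨z, rfl⟩ := QuotientAddGroup.mk_surjective a
    intro h
    obtain ⟨x, hx⟩ := mem_periodLattice_iff.1 ((QuotientAddGroup.eq_zero_iff (n • z)).1 h)
    refine ⟨x, ?_⟩
    rw [torsionPoint_apply, hx, ← Nat.cast_smul_eq_nsmul ℂ,
      inv_smul_smul₀ (by exact_mod_cast hn)]
  · rintro ⟨x, rfl⟩
    rw [← map_nsmul, ← natCast_zsmul, torsionPoint_smul hn]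

/-- In the coordinates of `A[n]`, the Weil pairing is `(x, y) ↦ exp (2 π i ω(x, y) / n)`. -/
theorem weilPairing_torsionPoint_eq_one_iff (hτ : τ ∈ siegelHalfSpace) (hn : n ≠ 0)
    (x y : Fin 2 ⊕ Fin 2 → ℤ)
    (hx : torsionPoint τ n x ∈ AddSubgroup.torsionBy (AbelianSurface τ) n)
    (hy : torsionPoint τ n y ∈ AddSubgroup.torsionBy (AbelianSurface τ) n) :
    weilPairing τ n ⟨torsionPoint τ n x, hx⟩ ⟨torsionPoint τ n y, hy⟩ = 1 ↔
      (n : ℤ) ∣ stdSymplectic x y := by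
  have hn' : (n : ℂ) ≠ 0 := by exact_mod_cast hn
  have hn'' : (n : ℝ) ≠ 0 := by exact_mod_cast hn
  have h₁ := weilPairing_mk hτ n ((n : ℂ)⁻¹ • latticeVector τ x) ((n : ℂ)⁻¹ • latticeVector τ y)
    hx hy
  have h₂ : (riemannForm τ ((n : ℂ)⁻¹ • latticeVector τ x) ((n : ℂ)⁻¹ • latticeVector τ y)).im =
      (n : ℝ)⁻¹ * ((n : ℝ)⁻¹ * stdSymplectic x y) := by
    rw [← riemannForm_im_latticeVector hτ, riemannForm, smul_dotProduct, star_smul, mulVec_smul,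
      dotProduct_smul, riemannForm]
    have : star (n : ℂ)⁻¹ = (n : ℂ)⁻¹ := by simp
    rw [this, smul_eq_mul, smul_eq_mul, ← Complex.ofReal_natCast, ← Complex.ofReal_inv,
      Complex.im_ofReal_mul, Complex.im_ofReal_mul]
  rw [h₂] at h₁
  simp only [torsionPoint_apply]
  rw [h₁, Complex.exp_eq_one_iff]
  constructor
  · rintro ⟨k, hk⟩
    refine ⟨k, ?_⟩
    push_cast at hk
    field_simp at hk
    exact_mod_cast hk
  · rintro ⟨k, hk⟩
    refine ⟨k, ?_⟩
    rw [hk]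
    push_cast
    field_simp

theorem isIsotropic_iff (hτ : τ ∈ siegelHalfSpace) (hn : n ≠ 0)
    {K : AddSubgroup (AbelianSurface τ)} :
    IsIsotropic τ n K ↔ K ≤ (torsionPoint τ n).range ∧
      ∀ x y, torsionPoint τ n x ∈ K → torsionPoint τ n y ∈ K → (n : ℤ) ∣ stdSymplectic x y := by
  constructor
  · rintro ⟨h, hK⟩
    refine ⟨torsionBy_eq_range_torsionPoint (τ := τ) hn ▸ h, fun x y hx hy => ?_⟩
    exact (weilPairing_torsionPoint_eq_one_iff hτ hn x y (h hx) (h hy)).1 (hK ⟨_, hx⟩ ⟨_, hy⟩)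
  · rintro ⟨h, hK⟩
    refine ⟨(torsionBy_eq_range_torsionPoint (τ := τ) hn).symm ▸ h, ?_⟩
    rintro ⟨a, ha⟩ ⟨b, hb⟩
    obtain ⟨x, rfl⟩ := h ha
    obtain ⟨y, rfl⟩ := h hb
    exact (weilPairing_torsionPoint_eq_one_iff hτ hn x y _ _).2 (hK x y ha hb)

theorem IsSelfDualLattice.isMaximalIsotropic_map (hτ : τ ∈ siegelHalfSpace) (hn : n ≠ 0)
    {M : AddSubgroup (Fin 2 ⊕ Fin 2 → ℤ)} (hM : IsSelfDualLattice n M) :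
    IsMaximalIsotropic τ n (M.map (torsionPoint τ n)) := by
  have hmem : ∀ x, torsionPoint τ n x ∈ M.map (torsionPoint τ n) ↔ x ∈ M := fun x => by
    rw [← AddSubgroup.mem_comap, comap_map_torsionPoint hτ hn hM.smul_mem]
  refine ⟨(isIsotropic_iff hτ hn).2 ⟨?_, fun x y hx hy => ?_⟩, fun K hK hMK a ha => ?_⟩
  · rintro _ ⟨x, -, rfl⟩
    exact ⟨x, rfl⟩
  · exact (hM x).1 ((hmem x).1 hx) y ((hmem y).1 hy)
  · obtain ⟨hr, hω⟩ := (isIsotropic_iff hτ hn).1 hK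
    obtain ⟨x, rfl⟩ := hr ha
    exact (hmem x).2 ((hM x).2 fun y hy => hω x y ha (hMK ((hmem y).2 hy)))

theorem IsMaximalIsotropic.isSelfDualLattice_comap (hτ : τ ∈ siegelHalfSpace) (hn : n ≠ 0)
    {K : AddSubgroup (AbelianSurface τ)} (hK : IsMaximalIsotropic τ n K) :
    IsSelfDualLattice n (K.comap (torsionPoint τ n)) := by
  obtain ⟨hr, hω⟩ := (isIsotropic_iff hτ hn).1 hK.prop
  intro x
  refine ⟨fun hx y hy => hω x y hx hy, fun hx => ?_⟩
  -- a vector orthogonal to `K` may be added to `K`, as the form is alternating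
  have hiso : IsIsotropic τ n (K ⊔ AddSubgroup.zmultiples (torsionPoint τ n x)) := by
    have hdec : ∀ y, torsionPoint τ n y ∈ K ⊔ AddSubgroup.zmultiples (torsionPoint τ n x) →
        ∃ (z : Fin 2 ⊕ Fin 2 → ℤ) (k : ℤ), torsionPoint τ n z ∈ K ∧ y = z + k • x := by
      intro y hy
      obtain ⟨a, ha, b, hb, hab⟩ := AddSubgroup.mem_sup.1 hy
      obtain ⟨k, rfl⟩ := AddSubgroup.mem_zmultiples_iff.1 hb
      refine ⟨y - k • x, k, ?_, by abel⟩
      rw [map_sub, map_zsmul, ← hab]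
      simpa using ha
    refine (isIsotropic_iff hτ hn).2 ⟨sup_le hr ?_, fun y y' hy hy' => ?_⟩
    · rw [AddSubgroup.zmultiples_le]
      exact ⟨x, rfl⟩
    · obtain ⟨z, k, hz, rfl⟩ := hdec y hy
      obtain ⟨z', k', hz', rfl⟩ := hdec y' hy'
      simp only [stdSymplectic_add_left, stdSymplectic_add_right, stdSymplectic_smul_left,
        stdSymplectic_smul_right, stdSymplectic_self, stdSymplectic_swap x z]
      have h₁ := hω z z' hz hz'
      have h₂ := hx z hz
      have h₃ := hx z' hz'
      exact dvd_add (dvd_add h₁ ((h₃).mul_left _)) ((by simpa using h₂ : (n : ℤ) ∣ -stdSymplectic x z + k * 0).mul_left _)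
  exact hK.le_of_ge hiso le_sup_left
    (AddSubgroup.mem_sup_right (AddSubgroup.mem_zmultiples _))

theorem IsMaximalIsotropic.map_comap (hτ : τ ∈ siegelHalfSpace) (hn : n ≠ 0)
    {K : AddSubgroup (AbelianSurface τ)} (hK : IsMaximalIsotropic τ n K) :
    (K.comap (torsionPoint τ n)).map (torsionPoint τ n) = K :=
  AddSubgroup.map_comap_eq_self ((isIsotropic_iff hτ hn).1 hK.prop).1

end

/-! ### Period matrices of the quotients -/

section

variable {τ : Matrix (Fin 2) (Fin 2) ℂ} {n : ℕ} {A B D : Matrix (Fin 2) (Fin 2) ℤ}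

theorem map_intCast_mul {R : Type*} [Ring R] (M N : Matrix (Fin 2) (Fin 2) ℤ) :
    (M * N).map (Int.cast : ℤ → R) = M.map Int.cast * N.map Int.cast :=
  Matrix.map_mul (f := Int.castRingHom R)

theorem map_intCast_mul_transpose {R : Type*} [Ring R] {M N : Matrix (Fin 2) (Fin 2) ℤ}
    (h : M * Nᵀ = (n : ℤ) • (1 : Matrix (Fin 2) (Fin 2) ℤ)) :
    M.map (Int.cast : ℤ → R) * (N.map Int.cast)ᵀ = (n : R) • (1 : Matrix (Fin 2) (Fin 2) R) := by
  rw [← transpose_map, ← map_intCast_mul, h]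
  rw [smul_one_eq_diagonal, smul_one_eq_diagonal, diagonal_map Int.cast_zero]
  simp

theorem siegelAction_fromBlocks (hn : n ≠ 0)
    (hAD : A * Dᵀ = (n : ℤ) • (1 : Matrix (Fin 2) (Fin 2) ℤ)) :
    siegelAction (fromBlocks A B 0 D) τ = (n : ℂ)⁻¹ •
      ((A.map (Int.cast : ℤ → ℂ) * τ + B.map (Int.cast : ℤ → ℂ)) * (A.map (Int.cast : ℤ → ℂ))ᵀ) := by
  have h : D * Aᵀ = (n : ℤ) • (1 : Matrix (Fin 2) (Fin 2) ℤ) := by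
    simpa using congrArg transpose hAD
  have hinv : (D.map (Int.cast : ℤ → ℂ))⁻¹ = (n : ℂ)⁻¹ • (A.map (Int.cast : ℤ → ℂ))ᵀ := by
    apply Matrix.inv_eq_right_inv
    rw [mul_smul_comm, map_intCast_mul_transpose h, inv_smul_smul₀ (by exact_mod_cast hn)]
  simp [siegelAction, hinv]

theorem siegelAction_im (hn : n ≠ 0)
    (hAD : A * Dᵀ = (n : ℤ) • (1 : Matrix (Fin 2) (Fin 2) ℤ)) :
    (siegelAction (fromBlocks A B 0 D) τ).map Complex.im = (n : ℝ)⁻¹ •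
      (A.map (Int.cast : ℤ → ℝ) * τ.map Complex.im * (A.map (Int.cast : ℤ → ℝ))ᵀ) := by
  rw [siegelAction_fromBlocks hn hAD]
  have hre : ((n : ℂ)⁻¹) = (((n : ℝ)⁻¹ : ℝ) : ℂ) := by simp
  ext i j
  rw [hre]
  simp [Matrix.mul_apply, Fin.sum_univ_two, -Complex.ofReal_inv, -Complex.ofReal_natCast]
  ring

theorem siegelAction_im_inv (hτ : τ ∈ siegelHalfSpace) (hn : n ≠ 0)
    (hAD : A * Dᵀ = (n : ℤ) • (1 : Matrix (Fin 2) (Fin 2) ℤ))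
    (hDA : Dᵀ * A = (n : ℤ) • (1 : Matrix (Fin 2) (Fin 2) ℤ)) :
    ((siegelAction (fromBlocks A B 0 D) τ).map Complex.im)⁻¹ = (n : ℝ)⁻¹ •
      (D.map (Int.cast : ℤ → ℝ) * (τ.map Complex.im)⁻¹ * (D.map (Int.cast : ℤ → ℝ))ᵀ) := by
  have hn' : (n : ℝ) ≠ 0 := by exact_mod_cast hn
  have h₁ := map_intCast_mul_transpose (R := ℝ) hAD
  have h₂ : (A.map (Int.cast : ℤ → ℝ))ᵀ * D.map (Int.cast : ℤ → ℝ) =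
      (n : ℝ) • (1 : Matrix (Fin 2) (Fin 2) ℝ) := by
    have := map_intCast_mul_transpose (R := ℝ) (M := Aᵀ) (N := Dᵀ) (n := n)
      (by simpa using congrArg transpose hDA)
    simpa [transpose_map] using this
  apply Matrix.inv_eq_right_inv
  rw [siegelAction_im hn hAD]
  generalize A.map (Int.cast : ℤ → ℝ) = A' at *
  generalize D.map (Int.cast : ℤ → ℝ) = D' at *
  have hu : IsUnit (τ.map Complex.im).det := hτ.2.det_pos.ne'.isUnit
  calc (n : ℝ)⁻¹ • (A' * τ.map Complex.im * A'ᵀ) * ((n : ℝ)⁻¹ • (D' * (τ.map Complex.im)⁻¹ * D'ᵀ))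
      = (n : ℝ)⁻¹ • (n : ℝ)⁻¹ •
          (A' * (τ.map Complex.im * ((A'ᵀ * D') * (τ.map Complex.im)⁻¹)) * D'ᵀ) := by
        rw [smul_mul_assoc, mul_smul_comm]
        simp only [Matrix.mul_assoc]
    _ = 1 := by
        rw [h₂, smul_mul_assoc, one_mul, mul_smul_comm, Matrix.mul_nonsing_inv _ hu, mul_smul_comm,
          mul_one, smul_mul_assoc, h₁, inv_smul_smul₀ hn', inv_smul_smul₀ hn']

theorem siegelAction_mem (hτ : τ ∈ siegelHalfSpace) (hn : n ≠ 0)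
    (hAD : A * Dᵀ = (n : ℤ) • (1 : Matrix (Fin 2) (Fin 2) ℤ)) (hAB : A * Bᵀ = B * Aᵀ) :
    siegelAction (fromBlocks A B 0 D) τ ∈ siegelHalfSpace := by
  constructor
  · rw [siegelAction_fromBlocks hn hAD]
    have h := congrArg (fun X => X.map (Int.cast : ℤ → ℂ)) hAB
    simp only [map_intCast_mul, transpose_map] at h
    rw [IsSymm, transpose_smul, transpose_mul, transpose_add, transpose_mul, hτ.1.eq,
      transpose_transpose, mul_add, add_mul, h, Matrix.mul_assoc]
  · rw [siegelAction_im hn hAD]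
    refine PosDef.smul ?_ (inv_pos.2 (by exact_mod_cast Nat.pos_of_ne_zero hn))
    have hinj : Function.Injective (A.map (Int.cast : ℤ → ℝ)).vecMul := by
      have hAD' := map_intCast_mul_transpose (R := ℝ) hAD
      intro u v huv
      have h := congrArg (fun w => w ᵥ* (D.map (Int.cast : ℤ → ℝ))ᵀ) huv
      simp only [vecMul_vecMul, hAD', vecMul_smul, vecMul_one] at h
      exact smul_right_injective _ (by exact_mod_cast hn : (n : ℝ) ≠ 0) h
    simpa using hτ.2.mul_mul_conjTranspose_same hinj

/-- Multiplication by `ᵗD` maps `ℤ² ⊕ (γτ) ℤ²` to the sublattice of `ℤ² ⊕ τ ℤ²` whose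
coordinates are spanned by the rows of `γ`. -/
theorem transpose_mulVec_latticeVector (hn : n ≠ 0)
    (hAD : A * Dᵀ = (n : ℤ) • (1 : Matrix (Fin 2) (Fin 2) ℤ))
    (hDA : Dᵀ * A = (n : ℤ) • (1 : Matrix (Fin 2) (Fin 2) ℤ)) (hAB : A * Bᵀ = B * Aᵀ)
    (c : Fin 2 ⊕ Fin 2 → ℤ) :
    (D.map (Int.cast : ℤ → ℂ))ᵀ *ᵥ latticeVector (siegelAction (fromBlocks A B 0 D) τ) c =
      latticeVector τ (c ᵥ* fromBlocks A B 0 D) := by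
  have hn' : (n : ℂ) ≠ 0 := by exact_mod_cast hn
  have hDA' : (D.map (Int.cast : ℤ → ℂ))ᵀ * A.map (Int.cast : ℤ → ℂ) =
      (n : ℂ) • (1 : Matrix (Fin 2) (Fin 2) ℂ) := by
    have := map_intCast_mul_transpose (R := ℂ) (M := Dᵀ) (N := Aᵀ) (n := n) (by simpa using hDA)
    simpa [transpose_map] using this
  have h := congrArg (fun X => X.map (Int.cast : ℤ → ℂ)) hAB
  simp only [map_intCast_mul, transpose_map] at h
  have key : (D.map (Int.cast : ℤ → ℂ))ᵀ * siegelAction (fromBlocks A B 0 D) τ =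
      τ * (A.map (Int.cast : ℤ → ℂ))ᵀ + (B.map (Int.cast : ℤ → ℂ))ᵀ := by
    rw [siegelAction_fromBlocks hn hAD, mul_smul_comm, add_mul, ← h, Matrix.mul_assoc, ← mul_add,
      ← Matrix.mul_assoc, hDA', smul_mul_assoc, one_mul, inv_smul_smul₀ hn']
  have cast : ∀ (v : Fin 2 → ℤ) (X : Matrix (Fin 2) (Fin 2) ℤ),
      (fun i => ((v ᵥ* X) i : ℂ)) = (X.map (Int.cast : ℤ → ℂ))ᵀ *ᵥ (fun i => (v i : ℂ)) := by
    intro v X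
    ext i
    simp [vecMul, mulVec, dotProduct, Fin.sum_univ_two, mul_comm]
  obtain ⟨q, p, rfl⟩ : ∃ q p : Fin 2 → ℤ, c = Sum.elim q p := ⟨c ∘ Sum.inl, c ∘ Sum.inr, by simp⟩
  rw [vecMul_fromBlocks, latticeVector_apply, latticeVector_apply]
  simp only [Sum.elim_inl, Sum.elim_inr, Sum.elim_comp_inl, Sum.elim_comp_inr, vecMul_zero,
    add_zero, cast, Pi.add_apply, Int.cast_add]
  rw [mulVec_add, mulVec_mulVec, key, add_mulVec, mulVec_mulVec]
  change _ = ((fun i => ((q ᵥ* B) i : ℂ)) + fun i => ((p ᵥ* D) i : ℂ)) + _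
  rw [cast, cast]
  abel

/-- For `γ = (A B; 0 D)` a symplectic similitude of multiplier `n`, the matrix `γτ` is a period
matrix of the quotient of `A` by the subgroup of `A[n]` spanned by the rows of `γ`; the
isomorphism is induced by `z ↦ ᵗD z / n`. -/
theorem isPeriodMatrixOfQuotient_rowLattice (hτ : τ ∈ siegelHalfSpace) (hn : n ≠ 0)
    (hAD : A * Dᵀ = (n : ℤ) • (1 : Matrix (Fin 2) (Fin 2) ℤ))
    (hDA : Dᵀ * A = (n : ℤ) • (1 : Matrix (Fin 2) (Fin 2) ℤ)) (hAB : A * Bᵀ = B * Aᵀ) :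
    IsPeriodMatrixOfQuotient τ n ((rowLattice (fromBlocks A B 0 D)).map (torsionPoint τ n))
      (siegelAction (fromBlocks A B 0 D) τ) := by
  have hn' : (n : ℂ) ≠ 0 := by exact_mod_cast hn
  have hM := isSelfDualLattice_rowLattice (by exact_mod_cast hn) hAD hDA hAB
  set τ' := siegelAction (fromBlocks A B 0 D) τ with hτ'
  set K := (rowLattice (fromBlocks A B 0 D)).map (torsionPoint τ n) with hK
  have hAD' := map_intCast_mul_transpose (R := ℂ) hAD
  have hDA' : (D.map (Int.cast : ℤ → ℂ))ᵀ * A.map (Int.cast : ℤ → ℂ) =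
      (n : ℂ) • (1 : Matrix (Fin 2) (Fin 2) ℂ) := by
    have := map_intCast_mul_transpose (R := ℂ) (M := Dᵀ) (N := Aᵀ) (n := n) (by simpa using hDA)
    simpa [transpose_map] using this
  let g : (Fin 2 → ℂ) ≃ₗ[ℂ] (Fin 2 → ℂ) := Matrix.toLin'OfInv
    (M := A.map (Int.cast : ℤ → ℂ)) (M' := (n : ℂ)⁻¹ • (D.map (Int.cast : ℤ → ℂ))ᵀ)
    (by rw [mul_smul_comm, hAD', inv_smul_smul₀ hn'])
    (by rw [smul_mul_assoc, hDA', inv_smul_smul₀ hn'])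
  have hg : ∀ z, g z = (n : ℂ)⁻¹ • ((D.map (Int.cast : ℤ → ℂ))ᵀ *ᵥ z) := by
    intro z
    rw [← smul_mulVec]
    exact Matrix.toLin'_apply _ z
  let f : (Fin 2 → ℂ) →+ AbelianSurface τ ⧸ K :=
    (quotientUniformization τ K).comp g.toLinearMap.toAddMonoidHom
  have hf : Function.Surjective f := by
    intro y
    obtain ⟨a, rfl⟩ := QuotientAddGroup.mk_surjective y
    obtain ⟨z, rfl⟩ := QuotientAddGroup.mk_surjective a
    refine ⟨g.symm z, ?_⟩
    change ((g (g.symm z) : AbelianSurface τ) : AbelianSurface τ ⧸ K) = _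
    rw [g.apply_symm_apply]
  have hker : periodLattice τ' = f.ker := by
    ext z
    have : f z = ((g z : AbelianSurface τ) : AbelianSurface τ ⧸ K) := rfl
    rw [AddMonoidHom.mem_ker, this, QuotientAddGroup.eq_zero_iff, hK,
      mk_mem_map_torsionPoint hn hM.smul_mem, mem_periodLattice_iff]
    have hgc : ∀ c, g (latticeVector τ' c) =
        (n : ℂ)⁻¹ • latticeVector τ (c ᵥ* fromBlocks A B 0 D) := by
      intro c
      rw [hg, transpose_mulVec_latticeVector hn hAD hDA hAB]
    constructor
    · rintro ⟨c, rfl⟩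
      exact ⟨_, mem_rowLattice.2 ⟨c, rfl⟩, (hgc c).symm⟩
    · rintro ⟨x, hx, h⟩
      obtain ⟨c, rfl⟩ := mem_rowLattice.1 hx
      exact ⟨c, g.injective (by rw [hgc, h])⟩
  refine ⟨siegelAction_mem hτ hn hAD hAB, QuotientAddGroup.liftEquiv _ hf hker, g,
    fun z => rfl, fun z w => ?_⟩
  change (n : ℂ) * riemannForm τ (g z) (g w) = _
  rw [riemannForm, riemannForm, hτ', siegelAction_im_inv hτ hn hAD hDA, hg, hg]
  generalize (τ.map Complex.im)⁻¹ = W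
  simp [dotProduct, mulVec, Matrix.mul_apply, Fin.sum_univ_two]
  field_simp
  ring

/-- A family of similitudes whose row lattices run exactly once through the preimages of the
subgroups satisfying `Q` parametrizes these subgroups together with their period matrices. -/
theorem exists_equiv_isPeriodMatrixOfQuotient (hτ : τ ∈ siegelHalfSpace) (hn : n ≠ 0)
    {S : Set (Matrix (Fin 2 ⊕ Fin 2) (Fin 2 ⊕ Fin 2) ℤ)}
    {Q : AddSubgroup (AbelianSurface τ) → Prop} (hQ : ∀ K, Q K → IsMaximalIsotropic τ n K)
    (hS : ∀ γ ∈ S, IsHermiteSimilitude n γ)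
    (hSQ : ∀ γ ∈ S, Q ((rowLattice γ).map (torsionPoint τ n)))
    (hinj : ∀ γ ∈ S, ∀ γ' ∈ S, rowLattice γ = rowLattice γ' → γ = γ')
    (hsurj : ∀ K, Q K → ∃ γ ∈ S, rowLattice γ = K.comap (torsionPoint τ n)) :
    ∃ e : S ≃ {K : AddSubgroup (AbelianSurface τ) // Q K},
      ∀ γ : S, IsPeriodMatrixOfQuotient τ n (e γ).1 (siegelAction γ.1 τ) := by
  have hn' : (n : ℤ) ≠ 0 := by exact_mod_cast hn
  let F : S → {K : AddSubgroup (AbelianSurface τ) // Q K} := fun γ =>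
    ⟨(rowLattice γ.1).map (torsionPoint τ n), hSQ γ.1 γ.2⟩
  have hF : Function.Bijective F := by
    constructor
    · intro γ γ' h
      have h' := congrArg (fun K => AddSubgroup.comap (torsionPoint τ n) K.1) h
      simp only [F] at h'
      rw [comap_map_torsionPoint hτ hn ((hS γ.1 γ.2).isSelfDualLattice hn').smul_mem,
        comap_map_torsionPoint hτ hn ((hS γ'.1 γ'.2).isSelfDualLattice hn').smul_mem] at h'
      exact Subtype.ext (hinj _ γ.2 _ γ'.2 h')
    · rintro ⟨K, hK⟩
      obtain ⟨γ, hγ, h⟩ := hsurj K hK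
      refine ⟨⟨γ, hγ⟩, Subtype.ext ?_⟩
      simp only [F]
      rw [h, (hQ K hK).map_comap hτ hn]
  refine ⟨Equiv.ofBijective F hF, fun γ => ?_⟩
  obtain ⟨A, B, D, h₁, h₂, h₃, h⟩ := (hS γ.1 γ.2).exists_blocks hn'
  simp only [Equiv.ofBijective_apply, F, h]
  exact isPeriodMatrixOfQuotient_rowLattice hτ hn h₁ h₂ h₃

/-! ### Lattices of type `(ℤ/ℓ)² × ℤ/ℓ²` -/

/-- The rank of `M` modulo `l` is exactly one: some vector of `M` does not vanish modulo `l`, and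
all `2 × 2` minors do. -/
def HasRankOneMod (l : ℤ) (M : AddSubgroup (Fin 2 ⊕ Fin 2 → ℤ)) : Prop :=
  (∃ x ∈ M, ∃ i, ¬ l ∣ x i) ∧ ∀ x ∈ M, ∀ y ∈ M, ∀ i j, l ∣ x i * y j - x j * y i

/-- In `(ℤ/ℓ)² × ℤ/ℓ²` the multiples of `ℓ` form a cyclic group of order `ℓ`, and `ℓK` is the
reduction of the lattice modulo `ℓ`. -/
theorem hasRankOneMod_of_addEquiv (hτ : τ ∈ siegelHalfSpace) {l : ℕ} (hl : l.Prime)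
    {M : AddSubgroup (Fin 2 ⊕ Fin 2 → ℤ)}
    (e : M.map (torsionPoint τ (l ^ 2)) ≃+ (ZMod l × ZMod l) × ZMod (l ^ 2)) :
    HasRankOneMod l M := by
  have hl0 : (l : ℤ) ≠ 0 := by exact_mod_cast hl.ne_zero
  have hn : l ^ 2 ≠ 0 := pow_ne_zero _ hl.ne_zero
  have hp : Prime (l : ℤ) := Nat.prime_iff_prime_int.1 hl
  have hcancel : ∀ a : ℤ, ((l ^ 2 : ℕ) : ℤ) ∣ l * a ↔ (l : ℤ) ∣ a := by
    intro a
    rw [Nat.cast_pow, sq, mul_dvd_mul_iff_left hl0]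
  constructor
  · let g := e.symm ((0, 0), 1)
    obtain ⟨x, hx, hxg⟩ := g.2
    refine ⟨x, hx, ?_⟩
    by_contra! h
    have hz : torsionPoint τ (l ^ 2) ((l : ℤ) • x) = 0 :=
      (torsionPoint_eq_zero_iff hτ hn).2 fun i => (hcancel _).2 (h i)
    have hg : (l : ℤ) • g = 0 := Subtype.ext (by
      rw [map_zsmul] at hz
      rw [AddSubgroup.coe_zsmul, ← hxg, hz]
      rfl)
    have := congrArg (fun y => (e y).2) hg
    simp only [g, map_zsmul, AddEquiv.apply_symm_apply, map_zero, Prod.smul_snd, Prod.snd_zero,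
      zsmul_one] at this
    rw [ZMod.intCast_zmod_eq_zero_iff_dvd] at this
    have := (hcancel 1).1 (by simpa using this)
    exact hp.not_isUnit (isUnit_of_dvd_one this)
  · intro x hx y hy i j
    obtain ⟨u, hu⟩ := ZMod.intCast_surjective (e ⟨_, x, hx, rfl⟩).2
    obtain ⟨w, hw⟩ := ZMod.intCast_surjective (e ⟨_, y, hy, rfl⟩).2
    -- any relation between `u` and `w` modulo `l` holds between `x` and `y` modulo `l`
    have key : ∀ s t : ℤ, (l : ℤ) ∣ s * u + t * w → ∀ i, (l : ℤ) ∣ s * x i + t * y i := by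
      intro s t hst i
      rw [← hcancel]
      have hz : torsionPoint τ (l ^ 2) ((l : ℤ) • (s • x + t • y)) = 0 := by
        have h0 : (l : ℤ) • (s • (⟨_, x, hx, rfl⟩ : M.map (torsionPoint τ (l ^ 2))) +
            t • (⟨_, y, hy, rfl⟩ : M.map (torsionPoint τ (l ^ 2)))) = 0 := by
          apply e.injective
          rw [map_zero, map_zsmul, map_add, map_zsmul, map_zsmul]
          refine Prod.ext (Prod.ext ?_ ?_) ?_
          · simp
          · simp
          · simp only [Prod.smul_snd, Prod.snd_add, Prod.snd_zero, ← hu, ← hw]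
            have := (ZMod.intCast_zmod_eq_zero_iff_dvd _ _).2 ((hcancel _).2 hst)
            simpa [mul_add] using this
        rw [map_zsmul, map_add, map_zsmul, map_zsmul]
        exact congrArg Subtype.val h0
      exact (torsionPoint_eq_zero_iff hτ hn).1 hz i
    by_cases h : (l : ℤ) ∣ u ∧ (l : ℤ) ∣ w
    · have h1 := key 1 0 (by simpa using h.1)
      simp only [one_mul, zero_mul, add_zero] at h1
      exact dvd_sub ((h1 i).mul_right _) ((h1 j).mul_right _)
    · have h1 := key w (-u) ⟨0, by ring⟩
      rw [not_and_or] at h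
      rcases h with h | h
      · refine (hp.dvd_or_dvd (?_ : (l : ℤ) ∣ u * (x i * y j - x j * y i))).resolve_left h
        have h2 : u * (x i * y j - x j * y i) =
            (w * x i + -u * y i) * x j - (w * x j + -u * y j) * x i := by ring
        rw [h2]
        exact dvd_sub ((h1 i).mul_right _) ((h1 j).mul_right _)
      · refine (hp.dvd_or_dvd (?_ : (l : ℤ) ∣ w * (x i * y j - x j * y i))).resolve_left h
        have h2 : w * (x i * y j - x j * y i) =
            (w * x i + -u * y i) * y j - (w * x j + -u * y j) * y i := by ring
        rw [h2]
        exact dvd_sub ((h1 i).mul_right _) ((h1 j).mul_right _)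

/-- If three integral linear forms, taken modulo `ℓ`, `ℓ` and `ℓ²`, cut out the relations between
the rows of `γ` modulo `ℓ²`, then the subgroup of `A[ℓ²]` spanned by the rows of `γ` is
`(ℤ/ℓ)² × ℤ/ℓ²`. -/
theorem nonempty_addEquiv_of_forms (hτ : τ ∈ siegelHalfSpace) {l : ℕ} (hl : l ≠ 0)
    {γ : Matrix (Fin 2 ⊕ Fin 2) (Fin 2 ⊕ Fin 2) ℤ} (v₁ v₂ v₃ : Fin 2 ⊕ Fin 2 → ℤ)
    (hs : ∀ a b c : ℤ, ∃ x, x ⬝ᵥ v₁ = a ∧ x ⬝ᵥ v₂ = b ∧ x ⬝ᵥ v₃ = c)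
    (hk : ∀ x, ((l : ℤ) ∣ x ⬝ᵥ v₁ ∧ (l : ℤ) ∣ x ⬝ᵥ v₂ ∧ (l : ℤ) ^ 2 ∣ x ⬝ᵥ v₃) ↔
      ∀ i, (l : ℤ) ^ 2 ∣ (x ᵥ* γ) i) :
    Nonempty ((rowLattice γ).map (torsionPoint τ (l ^ 2)) ≃+
      (ZMod l × ZMod l) × ZMod (l ^ 2)) := by
  let f : (Fin 2 ⊕ Fin 2 → ℤ) →+ (ZMod l × ZMod l) × ZMod (l ^ 2) :=
    { toFun := fun x => (((x ⬝ᵥ v₁ : ℤ), (x ⬝ᵥ v₂ : ℤ)), (x ⬝ᵥ v₃ : ℤ))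
      map_zero' := by simp
      map_add' := fun x y => by simp [add_dotProduct] }
  let h : (Fin 2 ⊕ Fin 2 → ℤ) →+ AbelianSurface τ :=
    (torsionPoint τ (l ^ 2)).comp γ.vecMulLinear.toAddMonoidHom
  have hf : Function.Surjective f := by
    rintro ⟨⟨a, b⟩, c⟩
    obtain ⟨a, rfl⟩ := ZMod.intCast_surjective a
    obtain ⟨b, rfl⟩ := ZMod.intCast_surjective b
    obtain ⟨c, rfl⟩ := ZMod.intCast_surjective c
    obtain ⟨x, rfl, rfl, rfl⟩ := hs a b c
    exact ⟨x, rfl⟩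
  have hker : f.ker = h.ker := by
    ext x
    have h1 : h x = 0 ↔ ∀ i, (l : ℤ) ^ 2 ∣ (x ᵥ* γ) i := by
      have := torsionPoint_eq_zero_iff hτ (pow_ne_zero 2 hl) (x := x ᵥ* γ)
      rw [Nat.cast_pow] at this
      exact this
    rw [AddMonoidHom.mem_ker, AddMonoidHom.mem_ker, h1, ← hk]
    simp only [f, AddMonoidHom.coe_mk, ZeroHom.coe_mk, Prod.mk_eq_zero,
      ZMod.intCast_zmod_eq_zero_iff_dvd, Nat.cast_pow, and_assoc]
  have hrange : (rowLattice γ).map (torsionPoint τ (l ^ 2)) = h.range := by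
    rw [rowLattice, AddMonoidHom.map_range]
  rw [hrange]
  exact ⟨(QuotientAddGroup.quotientKerEquivRange h).symm.trans
    ((QuotientAddGroup.quotientAddEquivOfEq hker.symm).trans
      (QuotientAddGroup.quotientKerEquivOfSurjective f hf))⟩

end

/-! ### The sets `S(ℓ)` and `S(ℓ²)` -/

theorem matrix_zero_eq : (0 : Matrix (Fin 2) (Fin 2) ℤ) = !![0, 0; 0, 0] := by
  ext i j
  fin_cases i <;> fin_cases j <;> rfl

theorem mem_heckeSet_iff {l : ℕ} {γ : Matrix (Fin 2 ⊕ Fin 2) (Fin 2 ⊕ Fin 2) ℤ} :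
    γ ∈ heckeSet l ↔
      (∃ a ∈ Set.Ico (0 : ℤ) l, ∃ b ∈ Set.Ico (0 : ℤ) l, ∃ c ∈ Set.Ico (0 : ℤ) l,
        γ = hermiteMatrix 1 0 1 a b b c l 0 l) ∨
      (∃ a ∈ Set.Ico (0 : ℤ) l, ∃ b ∈ Set.Ico (0 : ℤ) l,
        γ = hermiteMatrix l (-a) 1 0 0 0 b 1 a l) ∨
      (∃ a ∈ Set.Ico (0 : ℤ) l, γ = hermiteMatrix 1 0 l a 0 0 0 l 0 1) ∨
      γ = hermiteMatrix l 0 l 0 0 0 0 1 0 1 := by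
  simp only [hermiteMatrix, ← matrix_zero_eq]
  simp only [heckeSet, Set.mem_union, Set.mem_ofPred_eq, Set.mem_singleton_iff, or_assoc]

theorem mem_heckeSetSq_iff {l : ℕ} {γ : Matrix (Fin 2 ⊕ Fin 2) (Fin 2 ⊕ Fin 2) ℤ} :
    γ ∈ heckeSetSq l ↔
      (∃ a ∈ Set.Ico (0 : ℤ) l, ∃ b ∈ Set.Ico (0 : ℤ) l, ∃ d ∈ Set.Ico (0 : ℤ) (l ^ 2),
        γ = hermiteMatrix l (-b) 1 0 (a * l) a (a * b + d) l (b * l) (l ^ 2)) ∨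
      (∃ a ∈ Set.Ico (0 : ℤ) l, ∃ d ∈ Set.Ico (0 : ℤ) (l ^ 2),
        γ = hermiteMatrix 1 0 l d (-a) (-(l * a)) 0 (l ^ 2) 0 l) ∨
      (∃ a ∈ Set.Ico (0 : ℤ) l, γ = hermiteMatrix (l ^ 2) (-(a * l)) l 0 0 0 0 1 a l) ∨
      γ = hermiteMatrix l 0 (l ^ 2) 0 0 0 0 l 0 1 ∨
      (∃ a ∈ Set.Ico (0 : ℤ) l, ∃ b ∈ Set.Ico (0 : ℤ) l, ∃ c ∈ Set.Ico (0 : ℤ) l,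
        a * c ≡ b ^ 2 [ZMOD l] ∧ (a, b, c) ≠ (0, 0, 0) ∧
        γ = hermiteMatrix l 0 l a b b c l 0 l) := by
  simp only [hermiteMatrix, ← matrix_zero_eq]
  simp only [heckeSetSq, Set.mem_union, Set.mem_ofPred_eq, Set.mem_singleton_iff, or_assoc]

theorem isHermiteSimilitude_of_mem_heckeSet {l : ℕ} :
    ∀ γ ∈ heckeSet l, IsHermiteSimilitude l γ := by
  intro γ h
  rcases mem_heckeSet_iff.1 h with ⟨a, -, b, -, c, -, h⟩ | ⟨a, -, b, -, h⟩ | ⟨a, -, h⟩ | h <;>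
    exact ⟨_, _, _, _, _, _, _, _, _, _, by ring, by ring, by ring, by ring, h⟩

theorem isHermiteSimilitude_of_mem_heckeSetSq {l : ℕ} :
    ∀ γ ∈ heckeSetSq l, IsHermiteSimilitude (l ^ 2) γ := by
  intro γ h
  rcases mem_heckeSetSq_iff.1 h with ⟨a, -, b, -, d, -, h⟩ | ⟨a, -, d, -, h⟩ | ⟨a, -, h⟩ | h |
    ⟨a, -, b, -, c, -, -, -, h⟩ <;>
    exact ⟨_, _, _, _, _, _, _, _, _, _, by ring, by ring, by ring, by ring, h⟩

theorem eq_of_mem_Ico_of_dvd_sub {n a b : ℤ} (ha : a ∈ Set.Ico 0 n) (hb : b ∈ Set.Ico 0 n)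
    (h : n ∣ a - b) : a = b := by
  rw [← Int.emod_eq_of_lt ha.1 ha.2, ← Int.emod_eq_of_lt hb.1 hb.2]
  exact (Int.modEq_iff_dvd.2 h).symm

/-- Distinct elements of `S(ℓ)` span distinct lattices: the four families have different pivots,
and within each family the entries above the pivots are reduced. -/
theorem heckeSet_rowLattice_injective {l : ℕ} (hl : l.Prime) :
    ∀ γ ∈ heckeSet l, ∀ γ' ∈ heckeSet l, rowLattice γ = rowLattice γ' → γ = γ' := by
  intro γ hγ γ' hγ' h
  have hl0 : (0 : ℤ) < l := by exact_mod_cast hl.pos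
  have hl1 : (l : ℤ) ≠ 1 := by exact_mod_cast hl.one_lt.ne'
  have hl2 := hl1.symm
  rcases mem_heckeSet_iff.1 hγ with
    ⟨a, ha, b, hb, c, hc, rfl⟩ | ⟨a, ha, b, hb, rfl⟩ | ⟨a, ha, rfl⟩ | rfl <;>
  rcases mem_heckeSet_iff.1 hγ' with
    ⟨a', ha', b', hb', c', hc', rfl⟩ | ⟨a', ha', b', hb', rfl⟩ | ⟨a', ha', rfl⟩ | rfl <;>
  obtain ⟨h₁, h₂, h₃, h₄⟩ := hermiteMatrix_unique (by positivity) (by positivity)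
    (by positivity) (by positivity) h <;> try contradiction
  · obtain ⟨x₁, x₂, x₃, x₄, e₁, e₂, e₃, e₄⟩ := h₄ rfl rfl rfl rfl
    obtain rfl := eq_of_mem_Ico_of_dvd_sub ha ha' ⟨x₁, by linear_combination e₁⟩
    obtain rfl := eq_of_mem_Ico_of_dvd_sub hb hb' ⟨x₂, by linear_combination e₂⟩
    obtain rfl := eq_of_mem_Ico_of_dvd_sub hc hc' ⟨x₄, by linear_combination e₄⟩
    rfl
  · obtain rfl := eq_of_mem_Ico_of_dvd_sub ha ha' (by
      rw [← dvd_neg]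
      rwa [sub_neg_eq_add, neg_add_eq_sub, ← neg_sub] at h₃)
    obtain ⟨x₁, x₂, x₃, x₄, e₁, e₂, e₃, e₄⟩ := h₄ rfl rfl rfl rfl
    obtain rfl := eq_of_mem_Ico_of_dvd_sub hb hb' ⟨x₄, by linear_combination e₄ - a * e₃⟩
    rfl
  · obtain ⟨x₁, x₂, x₃, x₄, e₁, e₂, e₃, e₄⟩ := h₄ rfl rfl rfl rfl
    obtain rfl := eq_of_mem_Ico_of_dvd_sub ha ha' ⟨x₁, by linear_combination e₁⟩
    rfl
  · rfl

/-- The analogue of `heckeSet_rowLattice_injective` for the five families of `S(ℓ²)`. -/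
theorem heckeSetSq_rowLattice_injective {l : ℕ} (hl : l.Prime) :
    ∀ γ ∈ heckeSetSq l, ∀ γ' ∈ heckeSetSq l, rowLattice γ = rowLattice γ' → γ = γ' := by
  intro γ hγ γ' hγ' h
  have hl0 : (0 : ℤ) < l := by exact_mod_cast hl.pos
  have hl1 : (1 : ℤ) < l := by exact_mod_cast hl.one_lt
  have n1 : (l : ℤ) ≠ 1 := hl1.ne'
  have n2 := n1.symm
  have n3 : (l : ℤ) ^ 2 ≠ l := by nlinarith
  have n4 := n3.symm
  have n5 : (l : ℤ) ^ 2 ≠ 1 := by nlinarith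
  have n6 := n5.symm
  rcases mem_heckeSetSq_iff.1 hγ with ⟨a, ha, b, hb, d, hd, rfl⟩ | ⟨a, ha, d, hd, rfl⟩ |
    ⟨a, ha, rfl⟩ | rfl | ⟨a, ha, b, hb, c, hc, -, -, rfl⟩ <;>
  rcases mem_heckeSetSq_iff.1 hγ' with ⟨a', ha', b', hb', d', hd', rfl⟩ | ⟨a', ha', d', hd', rfl⟩ |
    ⟨a', ha', rfl⟩ | rfl | ⟨a', ha', b', hb', c', hc', -, -, rfl⟩ <;>
  obtain ⟨h₁, h₂, h₃, h₄⟩ := hermiteMatrix_unique (by positivity) (by positivity)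
    (by positivity) (by positivity) h <;> try contradiction
  · obtain rfl := eq_of_mem_Ico_of_dvd_sub hb hb' (by
      rw [← dvd_neg]
      rwa [sub_neg_eq_add, neg_add_eq_sub, ← neg_sub] at h₃)
    obtain ⟨x₁, x₂, x₃, x₄, e₁, e₂, e₃, e₄⟩ := h₄ rfl rfl rfl rfl
    obtain rfl := eq_of_mem_Ico_of_dvd_sub ha ha' ⟨x₃, by linear_combination e₃⟩
    obtain rfl := eq_of_mem_Ico_of_dvd_sub hd hd' ⟨x₄, by linear_combination e₄ - b * e₃⟩
    rfl
  · obtain ⟨x₁, x₂, x₃, x₄, e₁, e₂, e₃, e₄⟩ := h₄ rfl rfl rfl rfl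
    obtain rfl := eq_of_mem_Ico_of_dvd_sub ha ha' ⟨-x₂, by linear_combination -e₂⟩
    obtain rfl := eq_of_mem_Ico_of_dvd_sub hd hd' ⟨x₁, by linear_combination e₁⟩
    rfl
  · obtain ⟨k, hk⟩ := h₃
    obtain rfl := eq_of_mem_Ico_of_dvd_sub ha ha' ⟨-k, by
      apply mul_left_cancel₀ hl0.ne'
      linear_combination -hk⟩
    rfl
  · rfl
  · obtain ⟨x₁, x₂, x₃, x₄, e₁, e₂, e₃, e₄⟩ := h₄ rfl rfl rfl rfl
    obtain rfl := eq_of_mem_Ico_of_dvd_sub ha ha' ⟨x₁, by linear_combination e₁⟩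
    obtain rfl := eq_of_mem_Ico_of_dvd_sub hb hb' ⟨x₂, by linear_combination e₂⟩
    obtain rfl := eq_of_mem_Ico_of_dvd_sub hc hc' ⟨x₄, by linear_combination e₄⟩
    rfl

theorem emod_mem_Ico {n : ℤ} (hn : 0 < n) (a : ℤ) : a % n ∈ Set.Ico 0 n :=
  ⟨Int.emod_nonneg a hn.ne', Int.emod_lt_of_pos a hn⟩

/-- Every lattice which is self-dual for `ω / ℓ` is spanned by the rows of an element of `S(ℓ)`. -/
theorem exists_mem_heckeSet {l : ℕ} (hl : l.Prime) {M : AddSubgroup (Fin 2 ⊕ Fin 2 → ℤ)}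
    (hM : IsSelfDualLattice l M) : ∃ γ ∈ heckeSet l, rowLattice γ = M := by
  have hl0 : (0 : ℤ) < l := by exact_mod_cast hl.pos
  obtain ⟨α, β, δ, d₁, d₂, d₃, b₁, b₂, b₃, b₄, hα, hδ, hβ, hβ', h₁, h₂, h₃, h₄, rfl⟩ :=
    hM.exists_hermite hl0
  have hdvd : ∀ a : ℤ, 0 < a → a ∣ l → a = 1 ∨ a = l := by
    intro a ha h
    lift a to ℕ using ha.le
    exact_mod_cast (Nat.dvd_prime hl).1 (by exact_mod_cast h)
  rcases hdvd α hα ⟨_, h₁.symm⟩ with rfl | rfl <;> rcases hdvd δ hδ ⟨_, h₂.symm⟩ with rfl | rfl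
  · obtain rfl : β = 0 := by lia
    obtain rfl : d₁ = l := by lia
    obtain rfl : d₃ = l := by lia
    obtain rfl : d₂ = 0 := by lia
    obtain rfl : b₃ = b₂ := by lia
    refine ⟨_, mem_heckeSet_iff.2 (.inl ⟨_, emod_mem_Ico hl0 b₁, _, emod_mem_Ico hl0 b₃, _,
      emod_mem_Ico hl0 b₄, rfl⟩), ?_⟩
    exact rowLattice_hermiteMatrix_congr (-(b₁ / l)) (-(b₃ / l)) (-(b₃ / l)) (-(b₄ / l))
      (by rw [Int.emod_def]; ring) (by rw [Int.emod_def]; ring) (by rw [Int.emod_def]; ring)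
      (by rw [Int.emod_def]; ring)
  · obtain rfl : β = 0 := by lia
    obtain rfl : d₁ = l := by lia
    obtain rfl : d₃ = 1 := mul_left_cancel₀ hl0.ne' (by linear_combination h₂)
    obtain rfl : d₂ = 0 := mul_left_cancel₀ hl0.ne' (by linear_combination h₃)
    refine ⟨_, mem_heckeSet_iff.2 (.inr (.inr (.inl ⟨_, emod_mem_Ico hl0 b₁, rfl⟩))), ?_⟩
    exact rowLattice_hermiteMatrix_congr (-(b₁ / l)) (-b₂) (-b₂) (-b₄)
      (by rw [Int.emod_def]; ring) (by ring) (by linear_combination -h₄) (by ring)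
  · obtain rfl : d₁ = 1 := mul_left_cancel₀ hl0.ne' (by linear_combination h₁)
    obtain rfl : d₃ = l := by lia
    obtain rfl : d₂ = -β := by lia
    refine ⟨_, mem_heckeSet_iff.2 (.inr (.inl ⟨-β, ⟨by lia, by lia⟩, _,
      emod_mem_Ico hl0 (b₄ + b₃ * β), rfl⟩)), ?_⟩
    rw [neg_neg]
    exact rowLattice_hermiteMatrix_congr (-b₁) (-b₃) (-b₃) (-((b₄ + b₃ * β) / l))
      (by ring) (by linear_combination h₄) (by ring) (by rw [Int.emod_def]; ring)
  · obtain rfl : d₁ = 1 := mul_left_cancel₀ hl0.ne' (by linear_combination h₁)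
    obtain rfl : d₃ = 1 := mul_left_cancel₀ hl0.ne' (by linear_combination h₂)
    -- `β` is a multiple of `l` in the interval `(-l, 0]`
    obtain rfl : β = 0 := Int.eq_zero_of_abs_lt_dvd ⟨-d₂, by linear_combination h₃⟩
      (abs_lt.2 ⟨hβ, by lia⟩)
    obtain rfl : d₂ = 0 := mul_left_cancel₀ hl0.ne' (by linear_combination h₃)
    refine ⟨_, mem_heckeSet_iff.2 (.inr (.inr (.inr rfl))), ?_⟩
    exact rowLattice_hermiteMatrix_congr (-b₁) (-b₂) (-b₃) (-b₄)
      (by ring) (by ring) (by ring) (by ring)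

/-- Every lattice which is self-dual for `ω / ℓ²` and of rank one modulo `ℓ` is spanned by the rows
of an element of `S(ℓ²)`. -/
theorem exists_mem_heckeSetSq {l : ℕ} (hl : l.Prime) {M : AddSubgroup (Fin 2 ⊕ Fin 2 → ℤ)}
    (hM : IsSelfDualLattice (l ^ 2) M) (hR : HasRankOneMod l M) :
    ∃ γ ∈ heckeSetSq l, rowLattice γ = M := by
  have hl0 : (0 : ℤ) < l := by exact_mod_cast hl.pos
  have hl2 : (0 : ℤ) < (l : ℤ) ^ 2 := by positivity
  have hp : Prime (l : ℤ) := Nat.prime_iff_prime_int.1 hl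
  have hl1 : ¬ (l : ℤ) ∣ 1 := fun h => hp.not_isUnit (isUnit_of_dvd_one h)
  obtain ⟨α, β, δ, d₁, d₂, d₃, b₁, b₂, b₃, b₄, hα, hδ, hβ, hβ', h₁, h₂, h₃, h₄, rfl⟩ :=
    hM.exists_hermite hl2
  obtain ⟨hR₁, hR₂⟩ := hR
  have hminor := fun i j => hR₂ _ (hermiteMatrix_row_mem α β δ b₁ b₂ b₃ b₄ d₁ d₂ d₃ i) _
    (hermiteMatrix_row_mem α β δ b₁ b₂ b₃ b₄ d₁ d₂ d₃ j)
  -- a unit among these four minors excludes the pivots `(1, 1)`, `(1, l²)`, `(l², 1)`, `(l², l²)`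
  have m₁ : (l : ℤ) ∣ α * δ := by simpa using hminor (.inl 0) (.inl 1) (.inl 0) (.inl 1)
  have m₂ : (l : ℤ) ∣ α * d₃ := by simpa using hminor (.inl 0) (.inr 1) (.inl 0) (.inr 1)
  have m₃ : (l : ℤ) ∣ δ * d₁ := by simpa using hminor (.inl 1) (.inr 0) (.inl 1) (.inr 0)
  have m₄ : (l : ℤ) ∣ d₁ * d₃ := by simpa using hminor (.inr 0) (.inr 1) (.inr 0) (.inr 1)
  have hdvd : ∀ a : ℤ, 0 < a → a ∣ (l : ℤ) ^ 2 → a = 1 ∨ a = l ∨ a = l ^ 2 := by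
    intro a ha h
    lift a to ℕ using ha.le
    obtain ⟨k, hk, rfl⟩ := (Nat.dvd_prime_pow hl).1 (by exact_mod_cast h)
    interval_cases k <;> simp
  rcases hdvd α hα ⟨_, h₁.symm⟩ with rfl | rfl | rfl <;>
    rcases hdvd δ hδ ⟨_, h₂.symm⟩ with rfl | rfl | rfl
  · exact absurd (by simpa using m₁) hl1
  · obtain rfl : β = 0 := by lia
    obtain rfl : d₁ = l ^ 2 := by lia
    obtain rfl : d₃ = l := mul_left_cancel₀ hl0.ne' (by linear_combination h₂)
    obtain rfl : d₂ = 0 := mul_left_cancel₀ hl0.ne' (by linear_combination h₃)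
    obtain ⟨k, rfl⟩ : (l : ℤ) ∣ b₄ := by
      simpa [h₄] using hminor (.inl 0) (.inl 1) (.inl 0) (.inr 1)
    refine ⟨_, mem_heckeSetSq_iff.2 (.inr (.inl ⟨_, emod_mem_Ico hl0 (-b₂), _,
      emod_mem_Ico hl2 b₁, rfl⟩)), ?_⟩
    exact rowLattice_hermiteMatrix_congr (-(b₁ / l ^ 2)) (-b₂ / l) (-b₂ / l) (-k)
      (by rw [Int.emod_def]; ring) (by rw [Int.emod_def]; ring)
      (by rw [Int.emod_def]; linear_combination -h₄) (by ring)
  · obtain rfl : d₃ = 1 := mul_left_cancel₀ hl2.ne' (by linear_combination h₂)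
    exact absurd (by simpa using m₂) hl1
  · obtain rfl : d₁ = l := mul_left_cancel₀ hl0.ne' (by linear_combination h₁)
    obtain rfl : d₃ = l ^ 2 := by lia
    obtain rfl : d₂ = -β * l := by linear_combination h₃
    obtain ⟨k, rfl⟩ : (l : ℤ) ∣ b₁ := by
      simpa using hminor (.inl 0) (.inl 1) (.inl 1) (.inr 0)
    have hb₂ : b₂ = l * b₃ - β * (l * k) := by linear_combination -h₄
    refine ⟨_, mem_heckeSetSq_iff.2 (.inl ⟨_, emod_mem_Ico hl0 b₃, -β, ⟨by lia, by lia⟩, _,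
      emod_mem_Ico hl2 (b₄ + b₃ / l * (β * l) + b₃ % l * β), rfl⟩), ?_⟩
    rw [neg_neg]
    exact rowLattice_hermiteMatrix_congr (-k) (-(b₃ / l)) (-(b₃ / l))
      (-((b₄ + b₃ / l * (β * l) + b₃ % l * β) / l ^ 2))
      (by ring) (by rw [Int.emod_def, hb₂]; ring) (by rw [Int.emod_def]; ring)
      (by rw [Int.emod_def _ ((l : ℤ) ^ 2)]; ring)
  · obtain rfl : d₁ = l := mul_left_cancel₀ hl0.ne' (by linear_combination h₁)
    obtain rfl : d₃ = l := mul_left_cancel₀ hl0.ne' (by linear_combination h₂)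
    obtain rfl : d₂ = -β := mul_left_cancel₀ hl0.ne' (by linear_combination h₃)
    -- here the rank condition is what forces `β = 0`
    have hβ₀ : (l : ℤ) ∣ β * β := by
      simpa using hminor (.inl 1) (.inr 0) (.inl 0) (.inr 1)
    obtain rfl : β = 0 := Int.eq_zero_of_abs_lt_dvd ((hp.dvd_or_dvd hβ₀).elim id id)
      (abs_lt.2 ⟨hβ, by lia⟩)
    obtain rfl : b₃ = b₂ := mul_left_cancel₀ hl0.ne' (by linear_combination h₄)
    have hred : rowLattice (hermiteMatrix l 0 l (b₁ % l) (b₃ % l) (b₃ % l) (b₄ % l) l (-0) l) =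
        rowLattice (hermiteMatrix l 0 l b₁ b₃ b₃ b₄ l (-0) l) :=
      rowLattice_hermiteMatrix_congr (-(b₁ / l)) (-(b₃ / l)) (-(b₃ / l)) (-(b₄ / l))
        (by rw [Int.emod_def]; ring) (by rw [Int.emod_def]; ring) (by rw [Int.emod_def]; ring)
        (by rw [Int.emod_def]; ring)
    rw [neg_zero] at *
    rw [← hred] at hR₁ hR₂
    refine ⟨_, mem_heckeSetSq_iff.2 (.inr (.inr (.inr (.inr ⟨_, emod_mem_Ico hl0 b₁, _,
      emod_mem_Ico hl0 b₃, _, emod_mem_Ico hl0 b₄, ?_, ?_, rfl⟩)))), hred⟩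
    · have := hR₂ _ (hermiteMatrix_row_mem _ _ _ _ _ _ _ _ _ _ (.inl 0)) _
        (hermiteMatrix_row_mem _ _ _ _ _ _ _ _ _ _ (.inl 1)) (.inr 0) (.inr 1)
      refine (Int.modEq_iff_dvd.2 ?_).symm
      rw [sq]
      simpa using this
    · intro h
      simp only [Prod.mk.injEq] at h
      obtain ⟨x, hx, i, hi⟩ := hR₁
      obtain ⟨c, rfl⟩ := mem_rowLattice.1 hx
      refine hi ((forall_vecMul_hermiteMatrix (P := fun t => (l : ℤ) ∣ t)).2 ?_ i)
      rw [h.1, h.2.1, h.2.2]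
      simp
  · obtain rfl : d₁ = l := mul_left_cancel₀ hl0.ne' (by linear_combination h₁)
    obtain rfl : d₃ = 1 := mul_left_cancel₀ hl2.ne' (by linear_combination h₂)
    have hβ₀ : β = l * -d₂ := mul_left_cancel₀ hl0.ne' (by linear_combination h₃)
    obtain rfl : β = 0 := Int.eq_zero_of_abs_lt_dvd ⟨_, hβ₀⟩ (abs_lt.2 ⟨hβ, by lia⟩)
    obtain rfl : d₂ = 0 := mul_left_cancel₀ hl2.ne' (by linear_combination h₃)
    obtain ⟨k, rfl⟩ : (l : ℤ) ∣ b₁ := by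
      simpa using hminor (.inl 0) (.inr 1) (.inr 0) (.inr 1)
    have hb₃ : b₃ = l * b₂ := mul_left_cancel₀ hl0.ne' (by linear_combination h₄)
    refine ⟨_, mem_heckeSetSq_iff.2 (.inr (.inr (.inr (.inl rfl)))), ?_⟩
    exact rowLattice_hermiteMatrix_congr (-k) (-b₂) (-b₂) (-b₄)
      (by ring) (by ring) (by rw [hb₃]; ring) (by ring)
  · obtain rfl : d₁ = 1 := mul_left_cancel₀ hl2.ne' (by linear_combination h₁)
    exact absurd (by simpa using m₃) hl1
  · obtain rfl : d₁ = 1 := mul_left_cancel₀ hl2.ne' (by linear_combination h₁)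
    obtain rfl : d₃ = l := mul_left_cancel₀ hl0.ne' (by linear_combination h₂)
    obtain rfl : β = -(d₂ * l) := by linear_combination h₃
    obtain ⟨k, hk⟩ : (l : ℤ) ∣ b₄ - b₃ * d₂ := by
      rw [← dvd_neg]
      have := hminor (.inl 1) (.inr 0) (.inr 0) (.inr 1)
      simpa using this
    refine ⟨_, mem_heckeSetSq_iff.2 (.inr (.inr (.inl ⟨d₂, ⟨by nlinarith, by nlinarith⟩, rfl⟩))),
      ?_⟩
    exact rowLattice_hermiteMatrix_congr (-b₁) (-b₃) (-b₃) (-k) (by ring)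
      (mul_left_cancel₀ hl0.ne' (by linear_combination h₄)) (by ring) (by linear_combination -hk)
  · obtain rfl : d₁ = 1 := mul_left_cancel₀ hl2.ne' (by linear_combination h₁)
    obtain rfl : d₃ = 1 := mul_left_cancel₀ hl2.ne' (by linear_combination h₂)
    exact absurd (by simpa using m₄) hl1

/-- `nonempty_addEquiv_of_forms` in coordinates. -/
theorem nonempty_addEquiv_hermiteMatrix {τ : Matrix (Fin 2) (Fin 2) ℂ} (hτ : τ ∈ siegelHalfSpace)
    {l : ℕ} (hl : l ≠ 0) {α β δ b₁ b₂ b₃ b₄ d₁ d₂ d₃ : ℤ}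
    (r₁ s₁ t₁ u₁ r₂ s₂ t₂ u₂ r₃ s₃ t₃ u₃ : ℤ)
    (hs : ∀ a b c : ℤ, ∃ x₀ x₁ y₀ y₁ : ℤ, x₀ * r₁ + x₁ * s₁ + (y₀ * t₁ + y₁ * u₁) = a ∧
      x₀ * r₂ + x₁ * s₂ + (y₀ * t₂ + y₁ * u₂) = b ∧ x₀ * r₃ + x₁ * s₃ + (y₀ * t₃ + y₁ * u₃) = c)
    (hk : ∀ x₀ x₁ y₀ y₁ : ℤ, ((l : ℤ) ∣ x₀ * r₁ + x₁ * s₁ + (y₀ * t₁ + y₁ * u₁) ∧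
      (l : ℤ) ∣ x₀ * r₂ + x₁ * s₂ + (y₀ * t₂ + y₁ * u₂) ∧
      (l : ℤ) ^ 2 ∣ x₀ * r₃ + x₁ * s₃ + (y₀ * t₃ + y₁ * u₃)) ↔
      ((l : ℤ) ^ 2 ∣ x₀ * α + x₁ * β ∧ (l : ℤ) ^ 2 ∣ x₁ * δ ∧
      (l : ℤ) ^ 2 ∣ x₀ * b₁ + x₁ * b₃ + y₀ * d₁ ∧
      (l : ℤ) ^ 2 ∣ x₀ * b₂ + x₁ * b₄ + (y₀ * d₂ + y₁ * d₃))) :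
    Nonempty ((rowLattice (hermiteMatrix α β δ b₁ b₂ b₃ b₄ d₁ d₂ d₃)).map
      (torsionPoint τ (l ^ 2)) ≃+ (ZMod l × ZMod l) × ZMod (l ^ 2)) := by
  have dot : ∀ (x : Fin 2 ⊕ Fin 2 → ℤ) (r s t u : ℤ), x ⬝ᵥ Sum.elim ![r, s] ![t, u] =
      x (.inl 0) * r + x (.inl 1) * s + (x (.inr 0) * t + x (.inr 1) * u) := by
    intros
    simp [dotProduct, Fin.sum_univ_two]
  refine nonempty_addEquiv_of_forms hτ hl (Sum.elim ![r₁, s₁] ![t₁, u₁])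
    (Sum.elim ![r₂, s₂] ![t₂, u₂]) (Sum.elim ![r₃, s₃] ![t₃, u₃]) (fun a b c => ?_) fun x => ?_
  · obtain ⟨x₀, x₁, y₀, y₁, h⟩ := hs a b c
    refine ⟨Sum.elim ![x₀, x₁] ![y₀, y₁], ?_⟩
    simp only [dot]
    exact h
  · rw [forall_vecMul_hermiteMatrix (P := fun t => (l : ℤ) ^ 2 ∣ t)]
    simp only [dot]
    exact hk _ _ _ _

/-- The subgroups of `A[ℓ²]` spanned by the elements of `S(ℓ²)` are of type `(ℤ/ℓ)² × ℤ/ℓ²`. -/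
theorem nonempty_addEquiv_of_mem_heckeSetSq {τ : Matrix (Fin 2) (Fin 2) ℂ}
    (hτ : τ ∈ siegelHalfSpace) {l : ℕ} (hl : l.Prime) :
    ∀ γ ∈ heckeSetSq l, Nonempty ((rowLattice γ).map (torsionPoint τ (l ^ 2)) ≃+
      (ZMod l × ZMod l) × ZMod (l ^ 2)) := by
  have hl0 : (l : ℤ) ≠ 0 := by exact_mod_cast hl.ne_zero
  have hp : Prime (l : ℤ) := Nat.prime_iff_prime_int.1 hl
  have hcancel : ∀ a : ℤ, (l : ℤ) ^ 2 ∣ a * l ↔ (l : ℤ) ∣ a := by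
    intro a
    rw [sq, mul_dvd_mul_iff_right hl0]
  have bezout : ∀ a ∈ Set.Ico (0 : ℤ) l, a ≠ 0 → ∃ r s : ℤ, a * r + l * s = 1 := by
    intro a ha h0
    have : IsCoprime (l : ℤ) a := hp.coprime_iff_not_dvd.2 fun h =>
      absurd (Int.le_of_dvd (lt_of_le_of_ne ha.1 h0.symm) h) (not_le.2 ha.2)
    obtain ⟨s, r, h⟩ := this
    exact ⟨r, s, by linear_combination h⟩
  intro γ hγ
  rcases mem_heckeSetSq_iff.1 hγ with ⟨a, ha, b, hb, d, hd, rfl⟩ | ⟨a, ha, d, hd, rfl⟩ |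
    ⟨a, ha, rfl⟩ | rfl | ⟨a, ha, b, hb, c, hc, hac, h0, rfl⟩
  · refine nonempty_addEquiv_hermiteMatrix hτ hl.ne_zero 1 0 0 0 0 0 1 0 0 1 0 0
      (fun a b c => ⟨a, c, b, 0, by ring, by ring, by ring⟩) fun x₀ x₁ y₀ y₁ => ?_
    simp only [mul_one, mul_zero, add_zero, zero_add]
    constructor
    · rintro ⟨⟨p, rfl⟩, ⟨q, rfl⟩, ⟨r, rfl⟩⟩
      exact ⟨⟨p - r * b, by ring⟩, ⟨r, rfl⟩, ⟨r * a + q, by ring⟩,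
        ⟨p * a + r * (a * b + d) + q * b + y₁, by ring⟩⟩
    · rintro ⟨⟨p, hp⟩, ⟨r, rfl⟩, ⟨q, hq⟩, -⟩
      exact ⟨(hcancel _).1 ⟨p + r * b, by linear_combination hp⟩,
        (hcancel _).1 ⟨q - r * a, by linear_combination hq⟩, ⟨r, rfl⟩⟩
  · refine nonempty_addEquiv_hermiteMatrix hτ hl.ne_zero 0 1 0 0 0 0 0 1 1 0 0 0
      (fun a b c => ⟨c, a, 0, b, by ring, by ring, by ring⟩) fun x₀ x₁ y₀ y₁ => ?_
    simp only [mul_one, mul_zero, add_zero, zero_add]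
    constructor
    · rintro ⟨⟨p, rfl⟩, ⟨q, rfl⟩, ⟨r, rfl⟩⟩
      exact ⟨⟨r, rfl⟩, ⟨p, by ring⟩, ⟨r * d - p * a + y₀, by ring⟩, ⟨-r * a + q, by ring⟩⟩
    · rintro ⟨⟨r, rfl⟩, h, -, ⟨q, hq⟩⟩
      exact ⟨(hcancel _).1 h, (hcancel _).1 ⟨q + r * a, by linear_combination hq⟩, ⟨r, rfl⟩⟩
  · refine nonempty_addEquiv_hermiteMatrix hτ hl.ne_zero 0 1 0 0 0 0 0 1 0 0 1 0
      (fun a b c => ⟨0, a, c, b, by ring, by ring, by ring⟩) fun x₀ x₁ y₀ y₁ => ?_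
    simp only [mul_one, mul_zero, add_zero, zero_add]
    constructor
    · rintro ⟨⟨p, rfl⟩, ⟨q, rfl⟩, ⟨r, rfl⟩⟩
      exact ⟨⟨x₀ - p * a, by ring⟩, ⟨p, by ring⟩, ⟨r, rfl⟩, ⟨r * a + q, by ring⟩⟩
    · rintro ⟨-, h, ⟨r, rfl⟩, ⟨q, hq⟩⟩
      exact ⟨(hcancel _).1 h, (hcancel _).1 ⟨q - r * a, by linear_combination hq⟩, ⟨r, rfl⟩⟩
  · refine nonempty_addEquiv_hermiteMatrix hτ hl.ne_zero 1 0 0 0 0 0 1 0 0 0 0 1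
      (fun a b c => ⟨a, 0, b, c, by ring, by ring, by ring⟩) fun x₀ x₁ y₀ y₁ => ?_
    simp only [mul_one, mul_zero, add_zero, zero_add, hcancel]
    exact ⟨fun ⟨h₁, h₂, h₃⟩ => ⟨h₁, dvd_mul_left _ _, h₂, h₃⟩,
      fun ⟨h₁, _, h₂, h₃⟩ => ⟨h₁, h₂, h₃⟩⟩
  · obtain ⟨m, hm⟩ := hac.symm.dvd
    by_cases ha0 : a = 0
    · subst ha0
      obtain rfl : b = 0 := Int.eq_zero_of_abs_lt_dvd
        (hp.dvd_of_dvd_pow (n := 2) ⟨-m, by linear_combination -hm⟩)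
        (abs_lt.2 ⟨by linarith [hb.1, hb.2], hb.2⟩)
      obtain ⟨r, s, hrs⟩ := bezout c hc (by rintro rfl; exact h0 rfl)
      refine nonempty_addEquiv_hermiteMatrix hτ hl.ne_zero 1 0 0 0 0 0 1 0 0 c 0 l
        (fun a b e => ⟨a, e * r, b, e * s, by ring, by ring, by linear_combination e * hrs⟩)
        fun x₀ x₁ y₀ y₁ => ?_
      simp only [mul_one, mul_zero, add_zero, zero_add, hcancel]
      constructor
      · rintro ⟨h₁, h₂, h₃⟩
        refine ⟨h₁, ?_, h₂, h₃⟩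
        obtain ⟨k, hk⟩ := h₃
        exact ⟨r * (l * k - y₁) + s * x₁, by linear_combination r * hk - x₁ * hrs⟩
      · rintro ⟨h₁, -, h₂, h₃⟩
        exact ⟨h₁, h₂, h₃⟩
    · obtain ⟨r, s, hrs⟩ := bezout a ha ha0
      -- with `t = b r ≡ b / a`, the second row is `t` times the first one modulo `l`
      refine nonempty_addEquiv_hermiteMatrix hτ hl.ne_zero
        0 1 0 0 (b * s) (c * s + m * r) (-(b * r)) 1 a b l 0
        (fun a' b' c' => ⟨r * (c' - b * a'), a', s * (c' - b * a'),
          b' - r * (c' - b * a') * (b * s) - a' * (c * s + m * r) + s * (c' - b * a') * (b * r),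
          by ring, by ring, by linear_combination (c' - b * a') * hrs⟩)
        fun x₀ x₁ y₀ y₁ => ?_
      simp only [mul_one, mul_zero, add_zero, zero_add, hcancel]
      constructor
      · rintro ⟨⟨k, rfl⟩, ⟨w, hw⟩, ⟨e, he⟩⟩
        refine ⟨⟨r * (l * e - b * k - y₀) + s * x₀, by linear_combination r * he - x₀ * hrs⟩,
          ⟨k, rfl⟩, ⟨e, by linear_combination he⟩, ⟨b * r * e + w, ?_⟩⟩
        linear_combination b * r * he + l * hw - (b * x₀ + c * l * k) * hrs + l * k * r * hm
      · rintro ⟨-, ⟨k, rfl⟩, ⟨e, he⟩, ⟨f, hf⟩⟩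
        refine ⟨⟨k, rfl⟩, ⟨f - b * r * e, mul_left_cancel₀ hl0 ?_⟩, ⟨e, by linear_combination he⟩⟩
        linear_combination hf - b * r * he + (b * x₀ + c * l * k) * hrs - l * k * r * hm

theorem mainTheorem5 (τ : Matrix (Fin 2) (Fin 2) ℂ) (hτ : τ ∈ siegelHalfSpace)
    (l : ℕ) (hl : l.Prime) :
    (∃ e : heckeSet l ≃ {K : AddSubgroup (AbelianSurface τ) // IsMaximalIsotropic τ l K},
      ∀ γ : heckeSet l, IsPeriodMatrixOfQuotient τ l (e γ).1 (siegelAction γ.1 τ)) ∧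
    (∃ e : heckeSetSq l ≃ {K : AddSubgroup (AbelianSurface τ) //
        IsMaximalIsotropic τ (l ^ 2) K ∧ Nonempty (K ≃+ (ZMod l × ZMod l) × ZMod (l ^ 2))},
      ∀ γ : heckeSetSq l,
        IsPeriodMatrixOfQuotient τ (l ^ 2) (e γ).1 (siegelAction γ.1 τ)) := by
  have hn : l ^ 2 ≠ 0 := pow_ne_zero 2 hl.ne_zero
  have hsim : ∀ γ ∈ heckeSetSq l, IsHermiteSimilitude ((l ^ 2 : ℕ) : ℤ) γ := by
    rw [Nat.cast_pow]
    exact isHermiteSimilitude_of_mem_heckeSetSq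
  constructor
  · refine exists_equiv_isPeriodMatrixOfQuotient hτ hl.ne_zero (fun K hK => hK)
      isHermiteSimilitude_of_mem_heckeSet (fun γ hγ => ?_) (heckeSet_rowLattice_injective hl)
      fun K hK => exists_mem_heckeSet hl (hK.isSelfDualLattice_comap hτ hl.ne_zero)
    exact ((isHermiteSimilitude_of_mem_heckeSet γ hγ).isSelfDualLattice
      (by exact_mod_cast hl.ne_zero)).isMaximalIsotropic_map hτ hl.ne_zero
  · refine exists_equiv_isPeriodMatrixOfQuotient hτ hn (fun K hK => hK.1) hsim
      (fun γ hγ => ⟨?_, nonempty_addEquiv_of_mem_heckeSetSq hτ hl γ hγ⟩)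
      (heckeSetSq_rowLattice_injective hl) ?_
    · exact ((hsim γ hγ).isSelfDualLattice (by exact_mod_cast hn)).isMaximalIsotropic_map hτ hn
    · rintro K ⟨hK, ⟨e⟩⟩
      have hM := hK.isSelfDualLattice_comap hτ hn
      refine exists_mem_heckeSetSq hl (by simpa using hM) (hasRankOneMod_of_addEquiv hτ hl ?_)
      rw [hK.map_comap hτ hn]
      exact e
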